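/- **Setting.** Let $R,C\in\mathbb R^{n\times n}$ be entrywise non-negative with $R\mathbf 1=\mathbf 1$, $\mathbf 1^\top C=\mathbf 1^\top$. For a non-negative matrix $A$, let $\mathcal G_A$ be the directed graph in which $j$ sends to $i$ iff $a_{ij}>0$; assume that some node is the root of a directed spanning tree of $\mathcal G_R$ and also of one of $\mathcal G_{C^\top}$. Let $\pi_R,\pi_C\ge 0$ satisfy $\pi_R^\top R=\pi_R^\top$, $C\pi_C=\pi_C$, $\pi_R^\top\mathbf 1=\pi_C^\top\mathbf 1=1$, and put $p=\pi_C^\top\pi_R$. *Norms.* A pair of norms $\|\cdot\|_R,\|\cdot\|_C$ on $\mathbb R^n$ is called adapted if both are $\le\|\cdot\|_2$ and, for the induced matrix norms, $\|I-\mathbf 1\pi_R^\top\|_R\le 1$, $\|I-\pi_C\mathbf 1^\top\|_C\le1$, $\sigma_R:=\|R-\mathbf 1\pi_R^\top\|_R<1$ and $\sigma_C:=\|C-\pi_C\mathbf 1^\top\|_C<1$. For $X\in\mathbb R^{n\times m}$, $\|X\|_R$ and $\|X\|_C$ denote the Euclidean norm of the vector of the norms of the columns. *Objectives.* Let $f_1,\dots,f_n:\mathbb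 R^m\to\mathbb R$ be differentiable with $L$-Lipschitz gradients, $L>0$ (no convexity), and let $f=\sum_i f_i$ be bounded below, $f^*=\inf f$. For $X$ with rows $x_1,\dots,x_n$, let $\nabla\mathbf f(X)$ be the matrix with rows $\nabla f_i(x_i)$. *Iteration.* Given $\alpha>0$ and thresholds $e_{X,i,k},e_{Y,i,k}$, let $e_k=\max_i\max(e_{X,i,k},e_{Y,i,k})$ be non-increasing in $k$ with $S_e=\sum_{k\ge0}e_k<\infty$. Starting from equal rows, $X_0=\mathbf 1x_0^\top$, and $Y_0=\nabla\mathbf f(X_0)$, $\hat X_0=X_0$, $\hat Y_0=Y_0$, put $$X_{k+1}=X_k+(R-I)\hat X_k-\alpha Y_k,\qquad Y_{k+1}=Y_k+(C-I)\hat Y_k+\nabla\mathbf f(X_{k+1})-\nabla\mathbf f(X_k),$$ where row $i$ of $\hat X_{k+1}$ is row $i$ of $X_{k+1}$ if that differs from row $i$ of $\hat X_k$ by at least $e_{X,i,k+1}$ in Euclidean norm, and row $i$ of $\hat X_k$ otherwise; likewise for $\hat Y$ with $e_{Y,i,k+1}$. Let $\bar{\mathbf x}_k=X_k^\top\pi_R$.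 *Constants.* Given positive numbers $\delta_{R,C},\delta_{C,R},\delta_{2,R},\delta_{2,C}$, let $$P=\begin{bmatrix}\sigma_R+\alpha\sqrt nL&\alpha\delta_{R,C}\\(2+\alpha\sqrt nL)L\delta_{C,R}&\sigma_C+\alpha L\end{bmatrix},\quad \lambda=\rho(P),\quad \Psi=\sqrt{(p_{11}-p_{22})^2+4p_{12}p_{21}},$$ let $\underline\Psi$ be any number with $0<\underline\Psi\le\Psi$, and $$c_3=\|Y_0-\pi_C\mathbf 1^\top Y_0\|_C,\quad c_0=c_3/\underline\Psi,\quad c_1=1+L/\underline\Psi,\quad c_2=\Big[1+\sigma_R+\tfrac{2L+1+\sigma_C}{\underline\Psi}\Big]\sqrt n,$$ $$c_4=L+\tfrac{2L\delta_{C,R}+L}{\underline\Psi},\qquad c_5=\Big[1+\sigma_C+2L+\tfrac{(1+\sigma_R)(2L\delta_{C,R}+L)}{\underline\Psi}\Big]\sqrt n,$$ $$b_1=L\sqrt n\,p\,\delta_{2,R},\quad b_2=\delta_{2,C},\quad b_3=3L^3n\,p^2\delta_{2,R}^2,\quad b_4=3L\delta_{2,C}^2,$$ $$B=\tfrac{3Lp^2}{2}+\tfrac{c_1b_1+c_4b_2+c_0b_1+c_3b_2}{1-\lambda}+\tfrac{c_1^2b_3+c_4^2b_4}{(1-\lambda)^2}+\tfrac{c_2b_1+c_5b_2}{2},\quad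 \gamma=\alpha p-\alpha^2B,\quad k_0=\tfrac{\ln\alpha-\ln(1-\lambda)}{\ln\lambda}.$$ **Theorem (convergence of ET-PPG without convexity).** If $R$ and $C$ have positive diagonals, adapted pairs of norms exist. For every adapted pair there is a number $D>0$, depending only on $R$, $C$, $\pi_R$, $\pi_C$ and the two norms, such that for all $\delta_{R,C},\delta_{C,R},\delta_{2,R},\delta_{2,C}\ge D$ one has $\|\cdot\|_R\le\delta_{R,C}\|\cdot\|_C$, $\|\cdot\|_C\le\delta_{C,R}\|\cdot\|_R$, $\|\cdot\|_2\le\delta_{2,R}\|\cdot\|_R$, $\|\cdot\|_2\le\delta_{2,C}\|\cdot\|_C$ on $\mathbb R^n$, and the following holds for all $m$, $L$, $f_i$, $x_0$, thresholds, $\alpha$ and $\underline\Psi$ as above. If $$\alpha<\min\Big\{\frac{(1-\sigma_R)(1-\sigma_C)}{(\sqrt nL+\sqrt n+3)L\delta_{R,C}\delta_{C,R}},\frac1{\delta_{R,C}}\Big\}\quad\text{and}\quad \alpha<B^{-1}p,$$ then $\lambda<1$, $\gamma>0$, and for all $k\ge1$: 1. $$\frac1k\sum_{t=0}^{k-1}\|\nabla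 f(\bar{\mathbf x}_t)\|^2\le\frac{f(\bar{\mathbf x}_0)-f^*}{\gamma k}+\frac{(c_2b_1+c_5b_2)e_0S_e}{2(1-\lambda)^2\gamma k}+\alpha\frac{c_0b_1+c_3b_2}{(1-\lambda)\gamma k}\Big(1+\sum_{0\le t\le k_0}\|\nabla f(\bar{\mathbf x}_t)\|^2\Big)+\alpha^2\frac{c_0^2b_3+c_3^2b_4+(c_2^2b_3+c_5^2b_4)e_0S_e}{(1-\lambda)^2\gamma k}.$$ 2. $$\frac1k\sum_{t=0}^{k-1}\|X_t-\mathbf 1\bar{\mathbf x}_t^\top\|_R^2\le\frac2{(1-\lambda)^2k}\Big[c_0^2+c_1^2\alpha^2\sum_{t=0}^{k-2}\|\nabla f(\bar{\mathbf x}_t)\|^2+c_2^2\sum_{t=0}^{k-2}e_t^2\Big].$$ In particular both ergodic averages are $O(1/k)$, and $\|\nabla f(\bar{\mathbf x}_k)\|^2\to0$, $\|X_k-\mathbf 1\bar{\mathbf x}_k^\top\|_R^2\to0$. -/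

import Mathlib

open Filter
open scoped Topology

noncomputable section

namespace ETPPG

/-! ### Weight matrices and graphs -/

/-- `r` is the root of a directed spanning tree of the graph induced by the non-negative matrix
`A`, in which `j` sends information to `i` when `A i j > 0`. The tree is given by its parent map:
every node other than `r` receives from its parent, and following parents leads to `r`. -/
def IsSpanningTreeRoot {n : ℕ} (A : Matrix (Fin n) (Fin n) ℝ) (r : Fin n) : Prop :=
  ∃ parent : Fin n → Fin n,
    (∀ i, i ≠ r → 0 < A i (parent i)) ∧ ∀ i, ∃ k : ℕ, parent^[k] i = r

/-- `π` is a non-negative left eigenvector of `R` for the eigenvalue `1`, with entries of sum `1`. -/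
def IsLeftPerron {n : ℕ} (R : Matrix (Fin n) (Fin n) ℝ) (π : Fin n → ℝ) : Prop :=
  (∀ i, 0 ≤ π i) ∧ Matrix.vecMul π R = π ∧ ∑ i, π i = 1

/-- `π` is a non-negative right eigenvector of `C` for the eigenvalue `1`, with entries of sum `1`. -/
def IsRightPerron {n : ℕ} (C : Matrix (Fin n) (Fin n) ℝ) (π : Fin n → ℝ) : Prop :=
  (∀ i, 0 ≤ π i) ∧ Matrix.mulVec C π = π ∧ ∑ i, π i = 1

/-! ### Norms -/

/-- The Euclidean norm on `ℝⁿ`. -/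
def euclNorm {n : ℕ} (x : Fin n → ℝ) : ℝ := ‖WithLp.toLp 2 x‖

/-- The matrix norm induced by a norm `N` on `ℝⁿ`. -/
def opNorm {n : ℕ} (N : Seminorm ℝ (Fin n → ℝ)) (A : Matrix (Fin n) (Fin n) ℝ) : ℝ :=
  sInf {c : ℝ | 0 ≤ c ∧ ∀ x, N (Matrix.mulVec A x) ≤ c * N x}

/-- An `n × m` matrix, given by its `n` rows. -/
abbrev Stack (n m : ℕ) := Fin n → EuclideanSpace ℝ (Fin m)

/-- The norm of an `n × m` matrix: the Euclidean norm of the vector of the `N`-norms of its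
columns. -/
def stackNorm {n m : ℕ} (N : Seminorm ℝ (Fin n → ℝ)) (X : Stack n m) : ℝ :=
  √(∑ j, N (fun i => X i j) ^ 2)

/-- `N` is a norm on `ℝⁿ` adapted to the matrix `A` and the projection `J`: it is dominated by the
Euclidean norm, and the induced matrix norm satisfies `‖I - J‖ ≤ 1` (that is, `‖I - J‖ = 1` unless
`J = I`, since `I - J` is a projection) and `‖A - J‖ < 1`. -/
structure IsAdaptedNorm {n : ℕ} (A J : Matrix (Fin n) (Fin n) ℝ)
    (N : Seminorm ℝ (Fin n → ℝ)) : Prop where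
  definite : ∀ x, N x = 0 → x = 0
  le_eucl : ∀ x, N x ≤ euclNorm x
  proj_le : opNorm N (1 - J) ≤ 1
  contract : opNorm N (A - J) < 1

/-- The projection `1 π_Rᵀ`. -/
def projR {n : ℕ} (πR : Fin n → ℝ) : Matrix (Fin n) (Fin n) ℝ := Matrix.vecMulVec 1 πR

/-- The projection `π_C 1ᵀ`. -/
def projC {n : ℕ} (πC : Fin n → ℝ) : Matrix (Fin n) (Fin n) ℝ := Matrix.vecMulVec πC 1

/-! ### Objectives -/

/-- `g` is differentiable with an `L`-Lipschitz gradient. -/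
def IsLSmooth {m : ℕ} (L : ℝ) (g : EuclideanSpace ℝ (Fin m) → ℝ) : Prop :=
  Differentiable ℝ g ∧ ∀ x y, ‖gradient g x - gradient g y‖ ≤ L * ‖x - y‖

/-- The global objective `f = ∑ i, f i`. -/
def globalObj {n m : ℕ} (f : Fin n → EuclideanSpace ℝ (Fin m) → ℝ)
    (x : EuclideanSpace ℝ (Fin m)) : ℝ := ∑ i, f i x

/-! ### The event-triggered push-pull gradient iteration -/

/-- State of the iteration: the variables `X`, `Y` and their last broadcast values. -/
structure State (n m : ℕ) where
  X : Stack n m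
  Y : Stack n m
  Xhat : Stack n m
  Yhat : Stack n m

/-- A row is broadcast when it differs from its last broadcast value by at least the threshold. -/
def broadcast {n m : ℕ} (e : Fin n → ℝ) (new old : Stack n m) : Stack n m :=
  fun i => if e i ≤ ‖new i - old i‖ then new i else old i

/-- The iterates
`X_{k+1} = X_k + (R - I) (X_k + ζ_k) - α Y_k`,
`Y_{k+1} = Y_k + (C - I) (Y_k + ξ_k) + ∇f(X_{k+1}) - ∇f(X_k)`,
where `X_k + ζ_k = Xhat_k` and `Y_k + ξ_k = Yhat_k` are the last broadcast values. All agents start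
at the common point `x0`, with `Y_0 = ∇f(X_0)`, and everything is broadcast at time `0`. -/
def iter {n m : ℕ} (R C : Matrix (Fin n) (Fin n) ℝ) (f : Fin n → EuclideanSpace ℝ (Fin m) → ℝ)
    (α : ℝ) (eX eY : Fin n → ℕ → ℝ) (x0 : EuclideanSpace ℝ (Fin m)) : ℕ → State n m
  | 0 =>
    { X := fun _ => x0
      Y := fun i => gradient (f i) x0
      Xhat := fun _ => x0
      Yhat := fun i => gradient (f i) x0 }
  | k + 1 =>
    let s := iter R C f α eX eY x0 k
    let X' : Stack n m := fun i =>
      s.X i + ∑ j, (R - 1) i j • s.Xhat j - α • s.Y i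
    let Y' : Stack n m := fun i =>
      s.Y i + ∑ j, (C - 1) i j • s.Yhat j + gradient (f i) (X' i) - gradient (f i) (s.X i)
    { X := X'
      Y := Y'
      Xhat := broadcast (fun i => eX i (k + 1)) X' s.Xhat
      Yhat := broadcast (fun i => eY i (k + 1)) Y' s.Yhat }

/-- `e_k`, the largest of all the thresholds at time `k`. -/
def maxThreshold {n : ℕ} (eX eY : Fin n → ℕ → ℝ) (k : ℕ) : ℝ := ⨆ i, max (eX i k) (eY i k)

/-- `x̄ = Xᵀ π`. -/
def wavg {n m : ℕ} (π : Fin n → ℝ) (X : Stack n m) : EuclideanSpace ℝ (Fin m) :=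
  ∑ i, π i • X i

/-- The consensus error `‖X - 1 x̄ᵀ‖`. -/
def consensusError {n m : ℕ} (N : Seminorm ℝ (Fin n → ℝ)) (πR : Fin n → ℝ) (X : Stack n m) : ℝ :=
  stackNorm N (fun i => X i - wavg πR X)

/-- The tracking error `‖Y - π_C ŷᵀ‖`, where `ŷ = Yᵀ 1`. -/
def trackingError {n m : ℕ} (N : Seminorm ℝ (Fin n → ℝ)) (πC : Fin n → ℝ) (Y : Stack n m) : ℝ :=
  stackNorm N (fun i => Y i - πC i • ∑ j, Y j)

/-! ### The constants -/

/-- The real numbers on which the constants depend: the number `n` of agents, the smoothness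
constant `L`, the step size `α`, the contraction factors `σR`, `σC`, the comparison constants of
the norms, the lower bound `ψ` of `Ψ`, the number `p = π_Cᵀ π_R` and the initial tracking
error `y0`. -/
structure Params where
  n : ℕ
  L : ℝ
  α : ℝ
  σR : ℝ
  σC : ℝ
  δRC : ℝ
  δCR : ℝ
  δ2R : ℝ
  δ2C : ℝ
  ψ : ℝ
  p : ℝ
  y0 : ℝ

namespace Params

variable (q : Params)

def P : Matrix (Fin 2) (Fin 2) ℝ :=
  !![q.σR + q.α * √q.n * q.L, q.α * q.δRC;
     (2 + q.α * √q.n * q.L) * q.L * q.δCR, q.σC + q.α * q.L]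

/-- The spectral radius of `P`. -/
def lam : ℝ := (spectralRadius ℂ (q.P.map (algebraMap ℝ ℂ))).toReal

def Psi : ℝ := √((q.P 0 0 - q.P 1 1) ^ 2 + 4 * q.P 0 1 * q.P 1 0)

def c0 : ℝ := q.y0 / q.ψ
def c1 : ℝ := 1 + q.L / q.ψ
def c2 : ℝ := (1 + q.σR + (2 * q.L + 1 + q.σC) / q.ψ) * √q.n
def c3 : ℝ := q.y0
def c4 : ℝ := q.L + (2 * q.L * q.δCR + q.L) / q.ψ
def c5 : ℝ :=
  (1 + q.σC + 2 * q.L + (1 + q.σR) * (2 * q.L * q.δCR + q.L) / q.ψ) * √q.n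

def b1 : ℝ := q.L * √q.n * q.p * q.δ2R
def b2 : ℝ := q.δ2C
def b3 : ℝ := 3 * q.L ^ 3 * q.n * q.p ^ 2 * q.δ2R ^ 2
def b4 : ℝ := 3 * q.L * q.δ2C ^ 2

/-- The bracket in the second bound on the step size. -/
def bracket : ℝ :=
  3 * q.L * q.p ^ 2 / 2
    + (q.c1 * q.b1 + q.c4 * q.b2 + q.c0 * q.b1 + q.c3 * q.b2) / (1 - q.lam)
    + (q.c1 ^ 2 * q.b3 + q.c4 ^ 2 * q.b4) / (1 - q.lam) ^ 2
    + (q.c2 * q.b1 + q.c5 * q.b2) / 2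

def γ : ℝ := q.α * q.p - q.α ^ 2 * q.bracket

def k0 : ℝ := (Real.log q.α - Real.log (1 - q.lam)) / Real.log q.lam

/-- The first bound on the step size. -/
def StepBound1 : Prop :=
  q.α < min ((1 - q.σR) * (1 - q.σC) / ((√q.n * q.L + √q.n + 3) * q.L * q.δRC * q.δCR)) (1 / q.δRC)

/-- The second bound on the step size. -/
def StepBound2 : Prop := q.α < q.bracket⁻¹ * q.p

/-- The right-hand side of the bound on the ergodic average of the squared gradient norms, where
`G t` is `‖∇f(x̄_t)‖ ^ 2`, `gap` is `f(x̄_0) - f*`, `e0` is the first threshold and `Se` the sum of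
the thresholds. The natural numbers `t` with `0 ≤ t ≤ k0` are those below `⌊k0 + 1⌋₊` (there are
none if `k0 < 0`). -/
def gradBound (G : ℕ → ℝ) (gap e0 Se : ℝ) (k : ℕ) : ℝ :=
  gap / (q.γ * k)
    + (q.c2 * q.b1 + q.c5 * q.b2) * e0 * Se / (2 * (1 - q.lam) ^ 2 * q.γ * k)
    + q.α * ((q.c0 * q.b1 + q.c3 * q.b2) / ((1 - q.lam) * q.γ * k))
        * (1 + ∑ t ∈ Finset.range ⌊q.k0 + 1⌋₊, G t)
    + q.α ^ 2 * ((q.c0 ^ 2 * q.b3 + q.c3 ^ 2 * q.b4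
        + (q.c2 ^ 2 * q.b3 + q.c5 ^ 2 * q.b4) * e0 * Se) / ((1 - q.lam) ^ 2 * q.γ * k))

/-- The right-hand side of the bound on the ergodic average of the squared consensus errors, where
`G t` is `‖∇f(x̄_t)‖ ^ 2` and `e t` is the largest threshold at time `t`. -/
def consensusBound (G e : ℕ → ℝ) (k : ℕ) : ℝ :=
  2 / ((1 - q.lam) ^ 2 * k)
    * (q.c0 ^ 2 + q.c1 ^ 2 * q.α ^ 2 * ∑ t ∈ Finset.range (k - 1), G t
        + q.c2 ^ 2 * ∑ t ∈ Finset.range (k - 1), e t ^ 2)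

end Params

/-- The constants attached to a run of the iteration. -/
def runParams {n m : ℕ} (R C : Matrix (Fin n) (Fin n) ℝ) (πR πC : Fin n → ℝ)
    (NR NC : Seminorm ℝ (Fin n → ℝ)) (δRC δCR δ2R δ2C : ℝ) (L : ℝ)
    (f : Fin n → EuclideanSpace ℝ (Fin m) → ℝ) (x0 : EuclideanSpace ℝ (Fin m)) (α ψ : ℝ) :
    Params where
  n := n
  L := L
  α := α
  σR := opNorm NR (R - projR πR)
  σC := opNorm NC (C - projC πC)
  δRC := δRC
  δCR := δCR
  δ2R := δ2R
  δ2C := δ2C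
  ψ := ψ
  p := ∑ i, πC i * πR i
  y0 := trackingError NC πC (fun i => gradient (f i) x0)

/-- `‖∇f(x̄_t)‖ ^ 2` along a sequence of states. -/
def gradSq {n m : ℕ} (f : Fin n → EuclideanSpace ℝ (Fin m) → ℝ) (πR : Fin n → ℝ)
    (s : ℕ → State n m) (t : ℕ) : ℝ :=
  ‖gradient (globalObj f) (wavg πR (s t).X)‖ ^ 2

/-- `‖X_t - 1 x̄_tᵀ‖ ^ 2` along a sequence of states. -/
def consensusSq {n m : ℕ} (NR : Seminorm ℝ (Fin n → ℝ)) (πR : Fin n → ℝ)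
    (s : ℕ → State n m) (t : ℕ) : ℝ :=
  consensusError NR πR (s t).X ^ 2

/-- The ergodic average `(1 / k) ∑_{t < k} a t`. -/
def ergodicAvg (a : ℕ → ℝ) (k : ℕ) : ℝ := 1 / (k : ℝ) * ∑ t ∈ Finset.range k, a t

end ETPPG

end

noncomputable section

namespace ETPPG

/-! The average x̄ follows an inexact gradient method. Since π_Rᵀ(R − I) = 0, the broadcast values
drop out of its update (`wavg_iter_X`). Since 1ᵀ(C − I) = 0, the sum of the rows of Y is always the
sum of the local gradients (`sum_iter_Y`). Hence π_Rᵀ Y equals p ∇f(x̄) up to an error linear in the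
consensus error x and the tracking error y (`IsRun.norm_wavg_Y_sub_le`), and smoothness of f yields
a descent inequality with error terms in x and y (`IsRun.descent`).

The pair (x, y) satisfies a two-dimensional linear recursive inequality driven by g = ‖∇f(x̄)‖ and
the thresholds e. Explicit powers of a 2 × 2 matrix bound x and y by convolutions of λ^j with
combinations of αg and e (`le_geomConv_of_recursion`, `IsErrorSystem.errors_le`). Young's inequality
for these convolutions bounds their ℓ² sums. In the summed descent inequality the errors therefore
cost at most α²B ∑ g² plus a constant. The second step bound makes γ = αp − α²B positive, so ∑ g² is
bounded uniformly in k (`IsErrorSystem.γ_mul_sum_le`), and then so is ∑ x². Both rates and both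
limits follow.

The constants need care. With d the true constant comparing the Euclidean norm with the adapted
norms, the recursion is not dominated by P: its diagonal involves α√nLd where P has α√nL. Moreover f
is only nL-smooth, while B contains 3Lp²/2. Both defects are repaired by taking the δ's at least D =
12nd(1 + r), where r bounds R − I. The off-diagonal entries of the recursion are then at most a
quarter of those of P, which pays for the larger diagonal, and b₂ exceeds d by enough to pay for the
factor n.

Adapted norms exist because, with positive diagonals, some power of R has a positive column at the
root, and some power of C a positive row. That power contracts the oscillation, respectively the ℓ¹
norm on vectors of sum zero. A weighted sum over the lower powers turns this into a norm contracted
in one step (`exists_isAdaptedNorm`). -/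

/-! ### Induced norms -/

/-- The Euclidean norm on `ℝⁿ` as a seminorm. -/
def euclSeminorm (n : ℕ) : Seminorm ℝ (Fin n → ℝ) :=
  (normSeminorm ℝ (EuclideanSpace ℝ (Fin n))).comp
    (WithLp.linearEquiv 2 ℝ (Fin n → ℝ)).symm.toLinearMap

@[simp] lemma euclSeminorm_apply {n : ℕ} (x : Fin n → ℝ) : euclSeminorm n x = euclNorm x := rfl

lemma euclNorm_sq {n : ℕ} (x : Fin n → ℝ) : euclNorm x ^ 2 = ∑ i, x i ^ 2 := by
  simp [euclNorm, EuclideanSpace.norm_sq_eq]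

lemma euclNorm_nonneg {n : ℕ} (x : Fin n → ℝ) : 0 ≤ euclNorm x := norm_nonneg _

/-- Compactness: a definite seminorm dominated by the Euclidean norm is continuous and has a
positive minimum on the unit sphere. -/
lemma exists_euclNorm_le {n : ℕ} (N : Seminorm ℝ (Fin n → ℝ)) (hdef : ∀ x, N x = 0 → x = 0)
    (hle : ∀ x, N x ≤ euclNorm x) : ∃ d : ℝ, 0 ≤ d ∧ ∀ x, euclNorm x ≤ d * N x := by
  let F : EuclideanSpace ℝ (Fin n) → ℝ := fun x => N x.ofLp
  have hF : Continuous F := by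
    refine (LipschitzWith.of_dist_le_mul (K := 1) fun x y => ?_).continuous
    rw [Real.dist_eq, dist_eq_norm, NNReal.coe_one, one_mul]
    exact (abs_sub_map_le_sub N _ _).trans (hle _)
  -- The sphere is empty exactly when n = 0, and then every norm vanishes.
  rcases (Metric.sphere (0 : EuclideanSpace ℝ (Fin n)) 1).eq_empty_or_nonempty with he | hne
  · refine ⟨0, le_rfl, fun x => ?_⟩
    by_contra! h
    have hx : 0 < ‖WithLp.toLp 2 x‖ := by simpa [euclNorm] using h
    have : ‖WithLp.toLp 2 x‖⁻¹ • WithLp.toLp 2 x ∈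
        Metric.sphere (0 : EuclideanSpace ℝ (Fin n)) 1 := by
      simp [norm_smul, hx.ne']
    simp [he] at this
  · obtain ⟨z, hz, hmin⟩ := (isCompact_sphere _ _).exists_isMinOn hne hF.continuousOn
    have hz0 : 0 < F z := by
      refine lt_of_le_of_ne (apply_nonneg N _) fun h => ?_
      have := hdef _ h.symm
      have hz' : z = 0 := by ext i; simpa using congrFun this i
      simp [hz'] at hz
    refine ⟨(F z)⁻¹, by positivity, fun x => ?_⟩
    rcases (euclNorm_nonneg x).eq_or_lt with h0 | hpos
    · rw [← h0]; have := apply_nonneg N x; positivity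
    · have hmem : (euclNorm x)⁻¹ • WithLp.toLp 2 x ∈
          Metric.sphere (0 : EuclideanSpace ℝ (Fin n)) 1 := by
        have : ‖WithLp.toLp 2 x‖ = euclNorm x := rfl
        simp [norm_smul, this, abs_of_pos hpos, hpos.ne']
      have h1 := hmin hmem
      have h2 : F ((euclNorm x)⁻¹ • WithLp.toLp 2 x) = (euclNorm x)⁻¹ * N x := by
        simp [F, map_smul_eq_mul, abs_of_pos hpos]
      simp only [Set.mem_ofPred_eq, h2] at h1
      rw [inv_mul_eq_div, le_div_iff₀ hz0]
      rw [inv_mul_eq_div, le_div_iff₀ hpos] at h1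
      linarith

lemma exists_euclNorm_mulVec_le {n : ℕ} (A : Matrix (Fin n) (Fin n) ℝ) :
    ∃ r : ℝ, 0 ≤ r ∧ ∀ x, euclNorm (A.mulVec x) ≤ r * euclNorm x := by
  refine ⟨‖Matrix.toEuclideanCLM (𝕜 := ℝ) A‖, norm_nonneg _, fun x => ?_⟩
  simpa [euclNorm] using (Matrix.toEuclideanCLM (𝕜 := ℝ) A).le_opNorm (WithLp.toLp 2 x)

section OpNorm
variable {n : ℕ} {N : Seminorm ℝ (Fin n → ℝ)}

lemma opNorm_nonneg (A : Matrix (Fin n) (Fin n) ℝ) : 0 ≤ opNorm N A :=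
  Real.sInf_nonneg fun _ h => h.1

lemma opNorm_le {A : Matrix (Fin n) (Fin n) ℝ} {c : ℝ} (hc : 0 ≤ c)
    (h : ∀ x, N (A.mulVec x) ≤ c * N x) : opNorm N A ≤ c :=
  csInf_le ⟨0, fun _ h => h.1⟩ ⟨hc, h⟩

/-- The infimum defining `opNorm` is itself an admissible bound. Equivalence with the Euclidean norm
makes the set of bounds nonempty; without this, `sInf` would take the meaningless value 0. -/
lemma le_opNorm (hdef : ∀ x, N x = 0 → x = 0) (hle : ∀ x, N x ≤ euclNorm x)
    (A : Matrix (Fin n) (Fin n) ℝ) (x : Fin n → ℝ) : N (A.mulVec x) ≤ opNorm N A * N x := by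
  rcases (apply_nonneg N x).eq_or_lt with h | h
  · rw [hdef x h.symm]; simp
  · obtain ⟨d, hd, hdN⟩ := exists_euclNorm_le N hdef hle
    obtain ⟨r, hr, hrA⟩ := exists_euclNorm_mulVec_le A
    rw [← div_le_iff₀ h]
    refine le_csInf ⟨r * d, by positivity, fun y => ?_⟩ fun c hc => ?_
    · calc N (A.mulVec y) ≤ r * euclNorm y := (hle _).trans (hrA y)
        _ ≤ r * (d * N y) := by gcongr; exact hdN y
        _ = r * d * N y := by ring
    · rw [div_le_iff₀ h]; exact hc.2 x

end OpNorm

/-! ### Norms of stacks of vectors -/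

/-- A stack of vectors as a matrix. -/
def Stack.mat {n m : ℕ} (X : Stack n m) : Matrix (Fin n) (Fin m) ℝ := Matrix.of fun i j => X i j

/-- The norm of a matrix: the Euclidean norm of the vector of the `N`-norms of its columns. -/
def matNorm {n m : ℕ} (N : Seminorm ℝ (Fin n → ℝ)) (A : Matrix (Fin n) (Fin m) ℝ) : ℝ :=
  ‖(WithLp.toLp 2 fun j => N (A.col j) : EuclideanSpace ℝ (Fin m))‖

lemma stackNorm_eq {n m : ℕ} (N : Seminorm ℝ (Fin n → ℝ)) (X : Stack n m) :
    stackNorm N X = matNorm N X.mat := by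
  simp only [stackNorm, matNorm, EuclideanSpace.norm_eq, Real.norm_eq_abs, sq_abs]
  rfl

section MatNorm
variable {n m : ℕ} {N N' : Seminorm ℝ (Fin n → ℝ)} {A B : Matrix (Fin n) (Fin m) ℝ}

lemma matNorm_nonneg : 0 ≤ matNorm N A := norm_nonneg _

lemma norm_toLp_mono {a b : Fin m → ℝ} (ha : ∀ j, 0 ≤ a j) (hab : ∀ j, a j ≤ b j) :
    ‖(WithLp.toLp 2 a : EuclideanSpace ℝ (Fin m))‖ ≤ ‖(WithLp.toLp 2 b : EuclideanSpace ℝ (Fin m))‖ := by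
  rw [EuclideanSpace.norm_eq, EuclideanSpace.norm_eq]
  refine Real.sqrt_le_sqrt (Finset.sum_le_sum fun j _ => ?_)
  simp only [Real.norm_eq_abs, sq_abs]
  exact pow_le_pow_left₀ (ha j) (hab j) 2

lemma matNorm_le_of_col {c : ℝ} (hc : 0 ≤ c) (h : ∀ j, N' (B.col j) ≤ c * N (A.col j)) :
    matNorm N' B ≤ c * matNorm N A := by
  refine (norm_toLp_mono (fun j => apply_nonneg _ _) h).trans_eq ?_
  have : (WithLp.toLp 2 fun j => c * N (A.col j) : EuclideanSpace ℝ (Fin m))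
      = c • WithLp.toLp 2 fun j => N (A.col j) := rfl
  rw [this, norm_smul, Real.norm_of_nonneg hc, matNorm]

lemma matNorm_mono (h : ∀ x, N' x ≤ N x) : matNorm N' A ≤ matNorm N A := by
  simpa using matNorm_le_of_col (N := N) (A := A) (B := A) zero_le_one
    (fun j => by simpa using h (A.col j))

lemma matNorm_le_mul {c : ℝ} (hc : 0 ≤ c) (h : ∀ x, N' x ≤ c * N x) :
    matNorm N' A ≤ c * matNorm N A :=
  matNorm_le_of_col hc fun _ => h _

lemma matNorm_mul_le {T : Matrix (Fin n) (Fin n) ℝ} {c : ℝ} (hc : 0 ≤ c)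
    (h : ∀ x, N' (T.mulVec x) ≤ c * N x) : matNorm N' (T * A) ≤ c * matNorm N A :=
  matNorm_le_of_col hc fun j => h (A.col j)

lemma matNorm_add_le : matNorm N (A + B) ≤ matNorm N A + matNorm N B := by
  set a : Fin m → ℝ := fun j => N (A.col j) with ha
  set b : Fin m → ℝ := fun j => N (B.col j) with hb
  have h : matNorm N (A + B) ≤ ‖(WithLp.toLp 2 (a + b) : EuclideanSpace ℝ (Fin m))‖ :=
    norm_toLp_mono (fun j => apply_nonneg N ((A + B).col j))
      fun j => map_add_le_add N (A.col j) (B.col j)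
  rw [WithLp.toLp_add] at h
  exact h.trans (norm_add_le _ _)

lemma matNorm_smul (c : ℝ) : matNorm N (c • A) = |c| * matNorm N A := by
  have : (WithLp.toLp 2 fun j => N ((c • A).col j) : EuclideanSpace ℝ (Fin m))
      = |c| • WithLp.toLp 2 fun j => N (A.col j) := by
    ext j
    exact map_smul_eq_mul N c (A.col j)
  rw [matNorm, this, norm_smul, Real.norm_eq_abs, abs_abs, matNorm]

lemma matNorm_neg : matNorm N (-A) = matNorm N A := by
  simpa using matNorm_smul (N := N) (A := A) (-1)

lemma matNorm_sub_le : matNorm N (A - B) ≤ matNorm N A + matNorm N B := by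
  rw [sub_eq_add_neg, ← matNorm_neg (A := B)]; exact matNorm_add_le

lemma matNorm_vecMulVec (v : Fin n → ℝ) (y : EuclideanSpace ℝ (Fin m)) :
    matNorm N (Matrix.vecMulVec v y) = N v * ‖y‖ := by
  have h : ∀ j, N ((Matrix.vecMulVec v y).col j) = N v * |y j| := fun j => by
    rw [mul_comm, ← Real.norm_eq_abs, ← map_smul_eq_mul]
    congr 1; ext i; simp [Matrix.vecMulVec_apply, mul_comm]
  simp only [matNorm, h, EuclideanSpace.norm_eq, Real.norm_eq_abs, sq_abs, mul_pow]
  rw [← Finset.mul_sum, Real.sqrt_mul (sq_nonneg _), Real.sqrt_sq (apply_nonneg _ _)]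

lemma matNorm_eucl_mat_sq (X : Stack n m) :
    matNorm (euclSeminorm n) X.mat ^ 2 = ∑ i, ‖X i‖ ^ 2 := by
  simp only [matNorm, EuclideanSpace.norm_sq_eq, Real.norm_eq_abs, sq_abs, euclSeminorm_apply,
    euclNorm_sq]
  rw [Finset.sum_comm]
  rfl

lemma matNorm_eucl_mat (X : Stack n m) :
    matNorm (euclSeminorm n) X.mat = √(∑ i, ‖X i‖ ^ 2) := by
  rw [← matNorm_eucl_mat_sq, Real.sqrt_sq matNorm_nonneg]

lemma norm_row_le_matNorm_eucl (X : Stack n m) (i : Fin n) :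
    ‖X i‖ ≤ matNorm (euclSeminorm n) X.mat := by
  rw [matNorm_eucl_mat]
  exact Real.le_sqrt_of_sq_le
    (Finset.single_le_sum (f := fun i => ‖X i‖ ^ 2) (fun _ _ => sq_nonneg _) (Finset.mem_univ i))

lemma matNorm_eucl_mat_le_of_rows {X X' : Stack n m} {c : ℝ} (hc : 0 ≤ c)
    (h : ∀ i, ‖X' i‖ ≤ c * ‖X i‖) :
    matNorm (euclSeminorm n) X'.mat ≤ c * matNorm (euclSeminorm n) X.mat := by
  refine abs_le_of_sq_le_sq' ?_ (mul_nonneg hc matNorm_nonneg) |>.2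
  rw [mul_pow, matNorm_eucl_mat_sq, matNorm_eucl_mat_sq, Finset.mul_sum]
  refine Finset.sum_le_sum fun i _ => ?_
  rw [← mul_pow]
  exact pow_le_pow_left₀ (norm_nonneg _) (h i) 2

lemma matNorm_eucl_mat_le_sqrt {X : Stack n m} {c : ℝ} (hc : 0 ≤ c) (h : ∀ i, ‖X i‖ ≤ c) :
    matNorm (euclSeminorm n) X.mat ≤ √n * c := by
  refine abs_le_of_sq_le_sq' ?_ (by positivity) |>.2
  rw [mul_pow, matNorm_eucl_mat_sq, Real.sq_sqrt (by positivity)]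
  refine (Finset.sum_le_sum fun i _ => pow_le_pow_left₀ (norm_nonneg _) (h i) 2).trans_eq ?_
  simp

lemma sum_norm_le_sqrt_mul (X : Stack n m) :
    ∑ i, ‖X i‖ ≤ √n * matNorm (euclSeminorm n) X.mat := by
  refine abs_le_of_sq_le_sq' ?_ (mul_nonneg (by positivity) matNorm_nonneg) |>.2
  rw [mul_pow, matNorm_eucl_mat_sq, Real.sq_sqrt (by positivity)]
  simpa using sq_sum_le_card_mul_sum_sq (s := Finset.univ) (f := fun i => ‖X i‖)

end MatNorm

/-! ### Existence of adapted norms -/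

/-! ### Positive columns in powers of stochastic matrices -/

section Roots
variable {n : ℕ} {R : Matrix (Fin n) (Fin n) ℝ}

lemma pow_succ_apply_pos (hR : R ∈ Matrix.rowStochastic ℝ (Fin n)) {k : ℕ} {i j r : Fin n}
    (hij : 0 < R i j) (hj : 0 < (R ^ k) j r) : 0 < (R ^ (k + 1)) i r := by
  have hk := pow_mem hR k
  rw [pow_succ', Matrix.mul_apply]
  exact (mul_pos hij hj).trans_le <| Finset.single_le_sum (f := fun l => R i l * (R ^ k) l r)
    (fun l _ => mul_nonneg (hR.1 i l) (hk.1 l r)) (Finset.mem_univ j)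

lemma pow_apply_pos_of_le (hR : R ∈ Matrix.rowStochastic ℝ (Fin n)) (hdiag : ∀ i, 0 < R i i)
    {k K : ℕ} (hkK : k ≤ K) {i r : Fin n} (h : 0 < (R ^ k) i r) : 0 < (R ^ K) i r := by
  induction K, hkK using Nat.le_induction with
  | base => exact h
  | succ K _ ih => exact pow_succ_apply_pos hR (hdiag i) ih

/-- A power of a row-stochastic matrix with positive diagonal has a positive column at the root of
a spanning tree. -/
lemma IsSpanningTreeRoot.exists_pow_pos (hR : R ∈ Matrix.rowStochastic ℝ (Fin n))
    (hdiag : ∀ i, 0 < R i i) {r : Fin n} (hr : IsSpanningTreeRoot R r) :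
    ∃ K : ℕ, 0 < K ∧ ∃ η : ℝ, 0 < η ∧ η < 1 ∧ ∀ i, η ≤ (R ^ K) i r := by
  obtain ⟨parent, hpos, hreach⟩ := hr
  have key : ∀ (k : ℕ) (i : Fin n), parent^[k] i = r → 0 < (R ^ k) i r := by
    intro k
    induction k with
    | zero => rintro i rfl; simp
    | succ k ih =>
      intro i hi
      -- The parent of the root is unconstrained, so a walk that has reached the root is padded by
      -- self-loops instead.
      by_cases hir : i = r
      · subst hir
        exact pow_apply_pos_of_le hR hdiag (Nat.zero_le _) (by simp)
      · exact pow_succ_apply_pos hR (hpos i hir) (ih _ hi)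
  choose k hk using hreach
  -- Self-loops stretch all walks to one common length; the extra 1 makes the exponent positive.
  refine ⟨Finset.univ.sup k + 1, Nat.succ_pos _, ?_⟩
  have hK : ∀ i, 0 < (R ^ (Finset.univ.sup k + 1)) i r := fun i =>
    pow_apply_pos_of_le hR hdiag ((Finset.le_sup (Finset.mem_univ i)).trans (Nat.le_succ _))
      (key _ i (hk i))
  have : Nonempty (Fin n) := ⟨r⟩
  obtain ⟨i₀, hi₀⟩ := Finite.exists_min fun i => (R ^ (Finset.univ.sup k + 1)) i r
  -- The cap 1/2 keeps the contraction factor 1 − η strictly positive.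
  refine ⟨min ((R ^ (Finset.univ.sup k + 1)) i₀ r) (1 / 2), lt_min (hK i₀) (by norm_num),
    (min_le_right _ _).trans_lt (by norm_num), fun i => (min_le_left _ _).trans (hi₀ i)⟩

end Roots

/-- The oscillation of a vector. -/
def oscSeminorm (n : ℕ) : Seminorm ℝ (Fin n → ℝ) :=
  (normSeminorm ℝ (Fin n × Fin n → ℝ)).comp
    (LinearMap.funLeft ℝ ℝ Prod.fst - LinearMap.funLeft ℝ ℝ Prod.snd)

lemma sub_le_oscSeminorm {n : ℕ} (x : Fin n → ℝ) (i j : Fin n) : x i - x j ≤ oscSeminorm n x :=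
  (le_abs_self _).trans (norm_le_pi_norm (fun p : Fin n × Fin n => x p.1 - x p.2) (i, j))

lemma oscSeminorm_le {n : ℕ} {x : Fin n → ℝ} {c : ℝ} (hc : 0 ≤ c) (h : ∀ i j, x i - x j ≤ c) :
    oscSeminorm n x ≤ c := by
  refine (pi_norm_le_iff_of_nonneg (x := fun p : Fin n × Fin n => x p.1 - x p.2) hc).2 fun p => ?_
  rw [Real.norm_eq_abs, abs_le]
  have h1 := h p.1 p.2
  have h2 := h p.2 p.1
  change -c ≤ x p.1 - x p.2 ∧ x p.1 - x p.2 ≤ c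
  constructor <;> linarith

/-- A row-stochastic matrix with a positive column contracts the oscillation. -/
lemma oscSeminorm_mulVec_le {n : ℕ} {B : Matrix (Fin n) (Fin n) ℝ}
    (hB : B ∈ Matrix.rowStochastic ℝ (Fin n)) {η : ℝ} (hη1 : η < 1) {r : Fin n}
    (h : ∀ i, η ≤ B i r) (x : Fin n → ℝ) :
    oscSeminorm n (B.mulVec x) ≤ (1 - η) * oscSeminorm n x := by
  have : Nonempty (Fin n) := ⟨r⟩
  obtain ⟨p, hp⟩ := Finite.exists_max x
  obtain ⟨q, hq⟩ := Finite.exists_min x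
  refine oscSeminorm_le (mul_nonneg (by linarith) (apply_nonneg _ _)) fun i j => ?_
  have hrow := Matrix.sum_row_of_mem_rowStochastic hB
  -- Every entry of Bx gives weight at least η to x r, so it stays below the maximum by η(x p − x r)
  -- and above the minimum by η(x r − x q). Together these remove η(x p − x q) from the oscillation.
  have h1 : η * (x p - x r) ≤ x p - B.mulVec x i := by
    calc η * (x p - x r) ≤ B i r * (x p - x r) := by
          gcongr
          · linarith [hp r]
          · exact h i
      _ ≤ ∑ l, B i l * (x p - x l) := Finset.single_le_sum (f := fun l => B i l * (x p - x l))
          (fun l _ => mul_nonneg (hB.1 i l) (sub_nonneg.2 (hp l))) (Finset.mem_univ r)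
      _ = x p - B.mulVec x i := by
          simp only [mul_sub, Finset.sum_sub_distrib, ← Finset.sum_mul, hrow, one_mul]
          rfl
  have h2 : η * (x r - x q) ≤ B.mulVec x j - x q := by
    calc η * (x r - x q) ≤ B j r * (x r - x q) := by
          gcongr
          · linarith [hq r]
          · exact h j
      _ ≤ ∑ l, B j l * (x l - x q) := Finset.single_le_sum (f := fun l => B j l * (x l - x q))
          (fun l _ => mul_nonneg (hB.1 j l) (sub_nonneg.2 (hq l))) (Finset.mem_univ r)
      _ = B.mulVec x j - x q := by
          simp only [mul_sub, Finset.sum_sub_distrib, ← Finset.sum_mul, hrow, one_mul]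
          rfl
  have h3 := mul_le_mul_of_nonneg_left (sub_le_oscSeminorm x p q) (sub_nonneg.2 hη1.le)
  linarith

/-- The `ℓ¹` norm. -/
def l1Seminorm (n : ℕ) : Seminorm ℝ (Fin n → ℝ) :=
  ∑ i, (normSeminorm ℝ ℝ).comp (LinearMap.proj i)

lemma l1Seminorm_apply {n : ℕ} (x : Fin n → ℝ) : l1Seminorm n x = ∑ i, |x i| := by
  simp [l1Seminorm]

/-- A column-stochastic matrix with a positive row contracts the `ℓ¹` norm of vectors with sum
zero. -/
lemma l1Seminorm_mulVec_le {n : ℕ} {B : Matrix (Fin n) (Fin n) ℝ}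
    (hB : B ∈ Matrix.colStochastic ℝ (Fin n)) {η : ℝ} {r : Fin n}
    (h : ∀ i, η ≤ B r i) {x : Fin n → ℝ} (hx : ∑ i, x i = 0) :
    l1Seminorm n (B.mulVec x) ≤ (1 - η) * l1Seminorm n x := by
  simp only [l1Seminorm_apply]
  have hrow : ∀ i, |B.mulVec x i| ≤ ∑ l, (B i l - if i = r then η else 0) * |x l| := fun i => by
    -- As x has sum zero, η may be subtracted from all of row r without changing Bx. The entries
    -- stay non-negative and the column sums drop to 1 − η.
    have : B.mulVec x i = ∑ l, (B i l - if i = r then η else 0) * x l := by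
      simp only [sub_mul, Finset.sum_sub_distrib, ← Finset.mul_sum, hx, mul_zero, sub_zero]
      rfl
    rw [this]
    refine (Finset.abs_sum_le_sum_abs _ _).trans (Finset.sum_le_sum fun l _ => ?_)
    rw [abs_mul, abs_of_nonneg]
    split_ifs with hi
    · subst hi; linarith [h l]
    · linarith [hB.1 i l]
  refine (Finset.sum_le_sum fun i _ => hrow i).trans_eq ?_
  rw [Finset.sum_comm, Finset.mul_sum]
  refine Finset.sum_congr rfl fun l _ => ?_
  rw [← Finset.sum_mul, Finset.sum_sub_distrib, Matrix.sum_col_of_mem_colStochastic hB]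
  simp

lemma Seminorm.exists_le_euclNorm {n : ℕ} (S : Seminorm ℝ (Fin n → ℝ)) :
    ∃ M : ℝ, 0 ≤ M ∧ ∀ x, S x ≤ M * euclNorm x := by
  refine ⟨∑ i, S (Pi.single i 1), Finset.sum_nonneg fun i _ => apply_nonneg _ _, fun x => ?_⟩
  have hx : x = ∑ i, x i • Pi.single (M := fun _ => ℝ) i 1 := by
    ext j; simp [Finset.sum_apply, Pi.single_apply]
  calc S x = S (∑ i, x i • Pi.single i 1) := by rw [← hx]
    _ ≤ ∑ i, S (x i • Pi.single i 1) :=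
        Finset.le_sum_of_subadditive S (map_zero S).le (map_add_le_add S) _ _
    _ ≤ ∑ i, S (Pi.single i 1) * euclNorm x := by
        refine Finset.sum_le_sum fun i _ => ?_
        rw [map_smul_eq_mul, mul_comm]
        gcongr
        exact PiLp.norm_apply_le (WithLp.toLp 2 x) i
    _ = _ := by rw [Finset.sum_mul]

/-- If a power of `A` contracts a norm on the kernel of `vᵀ`, where `vᵀ A = vᵀ` and `A u = u`, then
there is a norm adapted to `A` and the projection `u vᵀ`. -/
lemma exists_isAdaptedNorm {n : ℕ} {A : Matrix (Fin n) (Fin n) ℝ} {u v : Fin n → ℝ}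
    (hAu : A.mulVec u = u) (hvA : Matrix.vecMul v A = v) (hvu : v ⬝ᵥ u = 1)
    (s : Seminorm ℝ (Fin n → ℝ)) (hs : ∀ x, v ⬝ᵥ x = 0 → s x = 0 → x = 0) {K : ℕ} (hK : 0 < K)
    {κ : ℝ} (hκ0 : 0 < κ) (hκ1 : κ < 1)
    (hcontr : ∀ x, v ⬝ᵥ x = 0 → s ((A ^ K).mulVec x) ≤ κ * s x) :
    ∃ N : Seminorm ℝ (Fin n → ℝ), IsAdaptedNorm A (Matrix.vecMulVec u v) N := by
  set J := Matrix.vecMulVec u v with hJ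
  have hK' : (1 : ℝ) ≤ K := by exact_mod_cast hK
  -- The choice ρ = 1 − (1 − κ)/K works by Bernoulli's inequality and avoids K-th roots.
  obtain ⟨ρ, hρ0, hρ1, hρK⟩ : ∃ ρ : ℝ, 0 < ρ ∧ ρ < 1 ∧ κ ≤ ρ ^ K := by
    have h1 : (1 - κ) / K ≤ 1 - κ := div_le_self (by linarith) hK'
    have h2 : 0 < (1 - κ) / K := div_pos (by linarith) (by linarith)
    refine ⟨1 - (1 - κ) / K, by linarith, by linarith, ?_⟩
    have := one_add_mul_le_pow (a := -((1 - κ) / K)) (by linarith) K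
    have h3 : (K : ℝ) * -((1 - κ) / K) = -(1 - κ) := by field_simp
    rw [h3, ← sub_eq_add_neg, ← sub_eq_add_neg] at this
    linarith
  -- T(x) = ∑_{k<K} ρ^{-k} s(A^k x). Applying A shifts the sum, and the new last term ρ^{-K} s(A^K
  -- x) is at most the lost first term s(x), whence T(Ax) ≤ ρ T(x) on the kernel of vᵀ.
  let T : Seminorm ℝ (Fin n → ℝ) :=
    ∑ k ∈ Finset.range K, (ρ⁻¹ ^ k).toNNReal • s.comp (A ^ k).mulVecLin
  have hT : ∀ x, T x = ∑ k ∈ Finset.range K, ρ⁻¹ ^ k * s ((A ^ k).mulVec x) := fun x => by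
    simp only [T, sum_apply, smul_apply, NNReal.smul_def, smul_eq_mul]
    refine Finset.sum_congr rfl fun k _ => ?_
    rw [Real.coe_toNNReal _ (by positivity)]
    rfl
  have hTA : ∀ x, v ⬝ᵥ x = 0 → T (A.mulVec x) ≤ ρ * T x := fun x hx => by
    have h1 := Finset.sum_range_succ (fun k => ρ⁻¹ ^ k * s ((A ^ k).mulVec x)) K
    rw [Finset.sum_range_succ', ← hT] at h1
    have h2 : T (A.mulVec x) = ρ * ∑ k ∈ Finset.range K, ρ⁻¹ ^ (k + 1) * s ((A ^ (k + 1)).mulVec x) := by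
      rw [hT, Finset.mul_sum]
      refine Finset.sum_congr rfl fun k _ => ?_
      rw [Matrix.mulVec_mulVec, ← pow_succ, pow_succ ρ⁻¹]
      field_simp
    rw [h2]
    refine mul_le_mul_of_nonneg_left ?_ hρ0.le
    have h3 : ρ⁻¹ ^ K * s ((A ^ K).mulVec x) ≤ s x := by
      rw [inv_pow, inv_mul_le_iff₀ (by positivity)]
      exact (hcontr x hx).trans (by gcongr)
    simp only [pow_zero, Matrix.one_mulVec, one_mul] at h1
    linarith
  let V : (Fin n → ℝ) →ₗ[ℝ] ℝ := dotProductBilin ℝ ℝ v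
  have hV : ∀ x, V x = v ⬝ᵥ x := fun x => rfl
  -- The term |v ⬝ x| restores definiteness along u. It vanishes on the range of I − J, so I − J
  -- does not increase S.
  let S : Seminorm ℝ (Fin n → ℝ) := T.comp (1 - J).mulVecLin + (normSeminorm ℝ ℝ).comp V
  have hS : ∀ x, S x = T ((1 - J).mulVec x) + |v ⬝ᵥ x| := fun x => rfl
  obtain ⟨M, hM0, hM⟩ := Seminorm.exists_le_euclNorm S
  have hJmul : ∀ x, J.mulVec x = (v ⬝ᵥ x) • u := fun x => by
    rw [hJ, Matrix.vecMulVec_mulVec]; simp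
  have hvJ : ∀ x, v ⬝ᵥ (J.mulVec x) = v ⬝ᵥ x := fun x => by
    rw [hJmul, dotProduct_smul, hvu]; simp
  have hvA' : ∀ x, v ⬝ᵥ (A.mulVec x) = v ⬝ᵥ x := fun x => by
    rw [Matrix.dotProduct_mulVec, hvA]
  have hker : ∀ x, v ⬝ᵥ ((1 - J).mulVec x) = 0 := fun x => by
    rw [Matrix.sub_mulVec, dotProduct_sub, hvJ, Matrix.one_mulVec, sub_self]
  have hproj : ∀ x, v ⬝ᵥ x = 0 → (1 - J).mulVec x = x := fun x hx => by
    rw [Matrix.sub_mulVec, hJmul, hx]; simp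
  have hSker : ∀ x, v ⬝ᵥ x = 0 → S x = T x := fun x hx => by
    rw [hS, hproj x hx, hx]; simp
  have hTS : ∀ x, T ((1 - J).mulVec x) ≤ S x := fun x => by
    rw [hS]; exact le_add_of_nonneg_right (abs_nonneg _)
  let N : Seminorm ℝ (Fin n → ℝ) := ((M + 1)⁻¹).toNNReal • S
  have hN : ∀ x, N x = (M + 1)⁻¹ * S x := fun x => by
    simp only [N, smul_apply, NNReal.smul_def, smul_eq_mul]
    rw [Real.coe_toNNReal _ (by positivity)]
  refine ⟨N, ⟨fun x hx => ?_, fun x => ?_, ?_, ?_⟩⟩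
  · rw [hN] at hx
    have hS0 : S x = 0 := by
      rcases mul_eq_zero.1 hx with h | h
      · exact absurd h (by positivity)
      · exact h
    have hv0 : v ⬝ᵥ x = 0 := by
      have := apply_nonneg T ((1 - J).mulVec x)
      rw [hS] at hS0
      exact abs_eq_zero.1 (by linarith [abs_nonneg (v ⬝ᵥ x)])
    refine hs x hv0 ?_
    rw [hSker x hv0, hT] at hS0
    have := (Finset.sum_eq_zero_iff_of_nonneg fun k _ =>
      mul_nonneg (by positivity) (apply_nonneg s _)).1 hS0 0 (Finset.mem_range.2 hK)
    simpa using this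
  · rw [hN, inv_mul_le_iff₀ (by positivity)]
    linarith [hM x, euclNorm_nonneg x]
  · refine opNorm_le zero_le_one fun x => ?_
    rw [hN, hN, one_mul, hSker _ (hker x)]
    gcongr
    exact hTS x
  · refine (opNorm_le hρ0.le fun x => ?_).trans_lt hρ1
    have h1 : (A - J).mulVec x = A.mulVec ((1 - J).mulVec x) := by
      rw [Matrix.sub_mulVec, Matrix.sub_mulVec, Matrix.mulVec_sub, hJmul, Matrix.mulVec_smul, hAu]
      simp
    rw [hN, hN, h1, hSker _ (by rw [hvA', hker])]
    calc (M + 1)⁻¹ * T (A.mulVec ((1 - J).mulVec x))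
        ≤ (M + 1)⁻¹ * (ρ * S x) := by
          gcongr
          exact (hTA _ (hker x)).trans (by gcongr; exact hTS x)
      _ = ρ * ((M + 1)⁻¹ * S x) := by ring

lemma exists_isAdaptedNorm_rowStochastic {n : ℕ} {R : Matrix (Fin n) (Fin n) ℝ}
    (hR : R ∈ Matrix.rowStochastic ℝ (Fin n)) (hdiag : ∀ i, 0 < R i i) {r : Fin n}
    (hr : IsSpanningTreeRoot R r) {π : Fin n → ℝ} (hπ : IsLeftPerron R π) :
    ∃ N : Seminorm ℝ (Fin n → ℝ), IsAdaptedNorm R (projR π) N := by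
  obtain ⟨K, hK, η, hη0, hη1, hη⟩ := hr.exists_pow_pos hR hdiag
  refine exists_isAdaptedNorm (κ := 1 - η) hR.2 hπ.2.1 (by simpa [dotProduct] using hπ.2.2)
    (oscSeminorm n) (fun x hx h0 => ?_) hK (by linarith) (by linarith)
    (fun x _ => oscSeminorm_mulVec_le (pow_mem hR K) hη1 hη x)
  have hconst : ∀ i j, x i = x j := fun i j => by
    have h1 := sub_le_oscSeminorm x i j
    have h2 := sub_le_oscSeminorm x j i
    linarith
  ext i
  have : π ⬝ᵥ x = x i := by
    simp only [dotProduct, fun j => hconst j i, ← Finset.sum_mul, hπ.2.2, one_mul]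
  simpa [hx] using this.symm

lemma exists_isAdaptedNorm_colStochastic {n : ℕ} {C : Matrix (Fin n) (Fin n) ℝ}
    (hC : C ∈ Matrix.colStochastic ℝ (Fin n)) (hdiag : ∀ i, 0 < C i i) {r : Fin n}
    (hr : IsSpanningTreeRoot C.transpose r) {π : Fin n → ℝ} (hπ : IsRightPerron C π) :
    ∃ N : Seminorm ℝ (Fin n → ℝ), IsAdaptedNorm C (projC π) N := by
  obtain ⟨K, hK, η, hη0, hη1, hη⟩ := hr.exists_pow_pos
    (Matrix.transpose_mem_rowStochastic_iff_mem_colStochastic.2 hC) hdiag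
  refine exists_isAdaptedNorm (κ := 1 - η) hπ.2.1 hC.2 (by simpa [dotProduct] using hπ.2.2)
    (l1Seminorm n) (fun x _ h0 => ?_) hK (by linarith) (by linarith)
    (fun x hx => l1Seminorm_mulVec_le (r := r) (pow_mem hC K) (fun i => ?_)
      (by simpa [dotProduct] using hx))
  · rw [l1Seminorm_apply, Finset.sum_eq_zero_iff_of_nonneg fun _ _ => abs_nonneg _] at h0
    ext i
    simpa using h0 i (Finset.mem_univ i)
  · have := hη i
    rwa [← Matrix.transpose_pow, Matrix.transpose_apply] at this

/-! ### Two-by-two matrices -/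

section TwoByTwo
variable {M : Matrix (Fin 2) (Fin 2) ℝ} {a b : ℝ}

lemma mem_spectrum_map_iff (htr : a + b = M 0 0 + M 1 1)
    (hdet : a * b = M 0 0 * M 1 1 - M 0 1 * M 1 0) (z : ℂ) :
    z ∈ spectrum ℂ (M.map (algebraMap ℝ ℂ)) ↔ z = a ∨ z = b := by
  have htr' : (a : ℂ) + b = M 0 0 + M 1 1 := by exact_mod_cast htr
  have hdet' : (a : ℂ) * b = M 0 0 * M 1 1 - M 0 1 * M 1 0 := by exact_mod_cast hdet
  rw [spectrum.mem_iff, Matrix.isUnit_iff_isUnit_det, isUnit_iff_ne_zero, not_not,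
    Matrix.det_fin_two]
  simp only [Matrix.sub_apply, Matrix.algebraMap_matrix_apply, Matrix.map_apply]
  simp only [Fin.isValue, if_true, zero_ne_one, one_ne_zero, if_false, Algebra.algebraMap_self,
    RingHom.id_apply, Complex.coe_algebraMap]
  rw [← sub_eq_zero (a := z) (b := (a : ℂ)), ← sub_eq_zero (a := z) (b := (b : ℂ)), ← mul_eq_zero]
  exact ⟨fun h => by linear_combination h - z * htr' + hdet',
    fun h => by linear_combination h + z * htr' - hdet'⟩

lemma spectralRadius_map_eq (htr : a + b = M 0 0 + M 1 1)
    (hdet : a * b = M 0 0 * M 1 1 - M 0 1 * M 1 0) (hab : |b| ≤ a) :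
    (spectralRadius ℂ (M.map (algebraMap ℝ ℂ))).toReal = a := by
  have ha : 0 ≤ a := (abs_nonneg b).trans hab
  have hspec := mem_spectrum_map_iff htr hdet
  have h : spectralRadius ℂ (M.map (algebraMap ℝ ℂ)) = ENNReal.ofReal a := by
    refine le_antisymm (iSup₂_le fun z hz => ?_) ?_
    · have hz' : ‖z‖ ≤ a := by
        rcases (hspec z).1 hz with rfl | rfl
        · simp [abs_of_nonneg ha]
        · simpa using hab
      rw [← enorm_eq_nnnorm, ← ofReal_norm]
      exact ENNReal.ofReal_le_ofReal hz'
    · refine le_trans ?_ (le_iSup₂ (f := fun z (_ : z ∈ spectrum ℂ (M.map (algebraMap ℝ ℂ))) =>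
        (‖z‖₊ : ENNReal)) (a : ℂ) ((hspec a).2 (Or.inl rfl)))
      rw [← enorm_eq_nnnorm, ← ofReal_norm]
      simp [abs_of_nonneg ha]
  rw [h, ENNReal.toReal_ofReal ha]

/-- The divided differences `(a ^ k - b ^ k) / (a - b)`. -/
def divDiff (a b : ℝ) : ℕ → ℝ
  | 0 => 0
  | k + 1 => b * divDiff a b k + a ^ k

lemma divDiff_mul_sub (a b : ℝ) (k : ℕ) : divDiff a b k * (a - b) = a ^ k - b ^ k := by
  induction k with
  | zero => simp [divDiff]
  | succ k ih => rw [divDiff]; linear_combination b * ih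

lemma divDiff_nonneg (hab : |b| ≤ a) (hlt : b < a) (k : ℕ) : 0 ≤ divDiff a b k := by
  have h : 0 ≤ divDiff a b k * (a - b) := by
    rw [divDiff_mul_sub, sub_nonneg]
    calc b ^ k ≤ |b| ^ k := by rw [← abs_pow]; exact le_abs_self _
      _ ≤ a ^ k := by gcongr
  exact nonneg_of_mul_nonneg_left h (sub_pos.2 hlt)

/-- For b ≥ 0, replacing a by λ increases the divided difference to (λ^k − b^k)/(λ − b), and λ − b ≥
Ψ/4. For b ≤ 0, the recursion already gives at most λ^{k−1}, and Ψ ≤ 2λ. The estimate involves Ψ and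
not the gap a − b, which may be smaller. -/
lemma divDiff_le {lam Ψ : ℝ} (hab : |b| ≤ a) (hlt : b < a) (hal : a ≤ lam) (hΨ0 : 0 ≤ Ψ)
    (hΨ : Ψ ≤ 2 * lam) (hb : Ψ / 4 ≤ lam - b) (k : ℕ) : divDiff a b k * Ψ ≤ 4 * lam ^ k := by
  have ha : 0 ≤ a := (abs_nonneg b).trans hab
  have hlam : 0 ≤ lam := ha.trans hal
  rcases le_total 0 b with hb0 | hb0
  · have h : ∀ k, divDiff a b k * (lam - b) ≤ lam ^ k - b ^ k := by
      intro k
      induction k with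
      | zero => simp [divDiff]
      | succ k ih =>
        have h1 : a ^ k * (lam - b) ≤ lam ^ k * (lam - b) := by
          gcongr
          linarith
        have h2 := mul_le_mul_of_nonneg_left ih hb0
        rw [divDiff, pow_succ, pow_succ]
        linarith
    have h1 := mul_le_mul_of_nonneg_left hb (divDiff_nonneg hab hlt k)
    have h2 := pow_nonneg hb0 k
    linarith [h k]
  · cases k with
    | zero => simp [divDiff]
    | succ k =>
      have h1 : divDiff a b (k + 1) ≤ lam ^ k := by
        have h2 := mul_nonpos_of_nonpos_of_nonneg hb0 (divDiff_nonneg hab hlt k)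
        have h3 : a ^ k ≤ lam ^ k := by gcongr
        rw [divDiff]; linarith
      calc divDiff a b (k + 1) * Ψ ≤ lam ^ k * (2 * lam) := by gcongr
        _ ≤ 4 * lam ^ (k + 1) := by
          rw [pow_succ]
          have : 0 ≤ lam ^ k * lam := by positivity
          linarith

/-- Cayley–Hamilton in the form M(M − a) = b(M − a), iterated. -/
lemma pow_eq_divDiff (htr : a + b = M 0 0 + M 1 1)
    (hdet : a * b = M 0 0 * M 1 1 - M 0 1 * M 1 0) (k : ℕ) :
    M ^ k = divDiff a b k • (M - a • (1 : Matrix (Fin 2) (Fin 2) ℝ)) + a ^ k • 1 := by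
  have hCH : M * (M - a • (1 : Matrix (Fin 2) (Fin 2) ℝ)) = b • (M - a • 1) := by
    ext i j
    fin_cases i <;> fin_cases j <;>
      simp [Matrix.mul_apply, Fin.sum_univ_two, Matrix.one_apply] <;>
      first
      | linear_combination (-M 0 0) * htr + hdet
      | linear_combination (-M 0 1) * htr
      | linear_combination (-M 1 0) * htr
      | linear_combination (-M 1 1) * htr + hdet
  induction k with
  | zero => simp [divDiff]
  | succ k ih =>
    rw [pow_succ', ih, mul_add, mul_smul_comm, hCH, divDiff, mul_smul_comm, mul_one]
    module

end TwoByTwo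

/-! ### Linear recursive inequalities and geometric convolutions -/

/-- Solution of a linear recursive inequality. -/
lemma le_sum_pow_mulVec {d : ℕ} {M : Matrix (Fin d) (Fin d) ℝ} (hM : ∀ i j, 0 ≤ M i j)
    {u w : ℕ → Fin d → ℝ} (h0 : u 0 ≤ w 0) (h : ∀ k, u (k + 1) ≤ M.mulVec (u k) + w (k + 1))
    (k : ℕ) : u k ≤ ∑ t ∈ Finset.range (k + 1), (M ^ (k - t)).mulVec (w t) := by
  induction k with
  | zero => simpa using h0
  | succ k ih =>
    have h1 : M.mulVec (u k) ≤ ∑ t ∈ Finset.range (k + 1), (M ^ (k + 1 - t)).mulVec (w t) := by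
      have : ∑ t ∈ Finset.range (k + 1), (M ^ (k + 1 - t)).mulVec (w t)
          = M.mulVec (∑ t ∈ Finset.range (k + 1), (M ^ (k - t)).mulVec (w t)) := by
        rw [Matrix.mulVec_sum]
        refine Finset.sum_congr rfl fun t ht => ?_
        rw [Matrix.mulVec_mulVec, ← pow_succ', Nat.succ_sub (by simpa [Nat.lt_succ_iff] using ht)]
      rw [this]
      intro i
      simp only [Matrix.mulVec, dotProduct]
      exact Finset.sum_le_sum fun j _ => mul_le_mul_of_nonneg_left (ih j) (hM i j)
    rw [Finset.sum_range_succ]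
    simpa using (h k).trans (add_le_add_left h1 _)

/-- The causal convolution `∑ t ≤ k, r ^ (k - t) * w t`. -/
def geomConv (r : ℝ) (w : ℕ → ℝ) : ℕ → ℝ
  | 0 => w 0
  | k + 1 => r * geomConv r w k + w (k + 1)

lemma geomConv_eq_sum (r : ℝ) (w : ℕ → ℝ) (k : ℕ) :
    geomConv r w k = ∑ t ∈ Finset.range (k + 1), r ^ (k - t) * w t := by
  induction k with
  | zero => simp [geomConv]
  | succ k ih =>
    rw [geomConv, ih, Finset.sum_range_succ _ (k + 1), Finset.mul_sum]
    congr 1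
    · refine Finset.sum_congr rfl fun t ht => ?_
      rw [Nat.succ_sub (by simpa [Nat.lt_succ_iff] using ht), pow_succ]
      ring
    · simp

/-- A recursive inequality whose matrix is dominated by `[p₁₁ + ε, p₁₂ / 4; p₂₁ / 4, p₂₂ + ε]`,
where `ε` is small with respect to `p₁₂ p₂₁`, has solutions bounded in terms of the larger
eigenvalue `lam` of `[p₁₁, p₁₂; p₂₁, p₂₂]` and the difference `Ψ` of its eigenvalues. -/
lemma le_geomConv_of_recursion {p11 p12 p21 p22 ε Ψ lam : ℝ} (h11 : 0 ≤ p11) (h12 : 0 < p12)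
    (h21 : 0 < p21) (h22 : 0 ≤ p22) (hε : 0 ≤ ε)
    (hΨ : Ψ = √((p11 - p22) ^ 2 + 4 * p12 * p21)) (hlam : lam = (p11 + p22 + Ψ) / 2)
    (hεΨ : ε * Ψ ≤ 15 / 16 * (p12 * p21)) {x y F G : ℕ → ℝ} (hF : ∀ k, 0 ≤ F k)
    (hG : ∀ k, 0 ≤ G k) (hx0 : x 0 ≤ F 0) (hy0 : y 0 ≤ G 0)
    (hx : ∀ k, x (k + 1) ≤ (p11 + ε) * x k + p12 / 4 * y k + F (k + 1))
    (hy : ∀ k, y (k + 1) ≤ p21 / 4 * x k + (p22 + ε) * y k + G (k + 1)) (k : ℕ) :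
    x k ≤ geomConv lam (fun t => F t + p12 / Ψ * G t) k ∧
      y k ≤ geomConv lam (fun t => p21 / Ψ * F t + G t) k := by
  have hQ : 0 < p12 * p21 := mul_pos h12 h21
  have hΨ2 : Ψ ^ 2 = (p11 - p22) ^ 2 + 4 * p12 * p21 := by
    rw [hΨ, Real.sq_sqrt]; nlinarith [sq_nonneg (p11 - p22)]
  have hΨ0 : 0 < Ψ := by rw [hΨ]; apply Real.sqrt_pos.2; nlinarith [sq_nonneg (p11 - p22)]
  -- Φ is the eigenvalue gap of the perturbed matrix: quartering both off-diagonal entries turns 4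
  -- p₁₂p₂₁ into p₁₂p₂₁/4.
  set Φ := √((p11 - p22) ^ 2 + p12 * p21 / 4) with hΦ
  have hΦ2 : Φ ^ 2 = (p11 - p22) ^ 2 + p12 * p21 / 4 := by
    rw [hΦ, Real.sq_sqrt]; nlinarith [sq_nonneg (p11 - p22)]
  have hΦ0 : 0 < Φ := by rw [hΦ]; apply Real.sqrt_pos.2; nlinarith [sq_nonneg (p11 - p22)]
  have hΦΨ : Φ ≤ Ψ := by
    rw [hΦ, hΨ]; apply Real.sqrt_le_sqrt; nlinarith
  set M : Matrix (Fin 2) (Fin 2) ℝ := !![p11 + ε, p12 / 4; p21 / 4, p22 + ε] with hM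
  set a := (p11 + p22 + 2 * ε + Φ) / 2 with ha
  set b := (p11 + p22 + 2 * ε - Φ) / 2 with hb
  have htr : a + b = M 0 0 + M 1 1 := by simp [hM, ha, hb]; ring
  have hdet : a * b = M 0 0 * M 1 1 - M 0 1 * M 1 0 := by
    simp [hM, ha, hb]; linear_combination (-1 / 4) * hΦ2
  have hlt : b < a := by linarith
  have hab : |b| ≤ a := abs_le.2 ⟨by linarith, hlt.le⟩
  -- The gap shrinks by more than the diagonal grows, so a ≤ λ. Here Ψ² − Φ² = (15/4) p₁₂p₂₁ and Ψ +
  -- Φ ≤ 2Ψ, which is the source of 15/16.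
  have hgap : 2 * ε ≤ Ψ - Φ := by
    have h1 : (Ψ - Φ) * (Ψ + Φ) = 15 / 4 * (p12 * p21) := by linear_combination hΨ2 - hΦ2
    have h2 : 2 * ε * (Ψ + Φ) ≤ (Ψ - Φ) * (Ψ + Φ) := by nlinarith
    exact le_of_mul_le_mul_right h2 (by linarith)
  have hal : a ≤ lam := by linarith
  have hε4 : ε ≤ Ψ / 4 := by
    have : ε * Ψ ≤ Ψ / 4 * Ψ := by nlinarith [sq_nonneg (p11 - p22)]
    exact le_of_mul_le_mul_right this hΨ0
  have ha0 : 0 ≤ a := (abs_nonneg b).trans hab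
  have hh : ∀ j, divDiff a b j ≤ 4 * (lam ^ j / Ψ) := fun j => by
    rw [mul_div_assoc', le_div_iff₀ hΨ0]
    exact divDiff_le hab hlt hal hΨ0.le (by linarith) (by linarith) j
  have hh0 := divDiff_nonneg hab hlt
  have hpow : ∀ j, a ^ j ≤ lam ^ j := fun j => by gcongr
  -- Hence the diagonal entries of M are at most a, so the divided-difference term of M^j is
  -- non-positive on the diagonal and the diagonal of M^j is at most a^j.
  have habs : |p11 - p22| ≤ Φ := by
    rw [← Real.sqrt_sq_eq_abs, hΦ]; apply Real.sqrt_le_sqrt; linarith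
  obtain ⟨habs1, habs2⟩ := abs_le.1 habs
  have hMpow := pow_eq_divDiff htr hdet
  have hM00 : ∀ j, (M ^ j) 0 0 ≤ lam ^ j := fun j => by
    have h1 : (M ^ j) 0 0 = divDiff a b j * (p11 + ε - a) + a ^ j := by simp [hMpow j]; simp [hM]
    have h2 := mul_nonneg (hh0 j) (show 0 ≤ a - (p11 + ε) by linarith)
    linarith [hpow j]
  have hM11 : ∀ j, (M ^ j) 1 1 ≤ lam ^ j := fun j => by
    have h1 : (M ^ j) 1 1 = divDiff a b j * (p22 + ε - a) + a ^ j := by simp [hMpow j]; simp [hM]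
    have h2 := mul_nonneg (hh0 j) (show 0 ≤ a - (p22 + ε) by linarith)
    linarith [hpow j]
  have hM01 : ∀ j, (M ^ j) 0 1 ≤ lam ^ j * (p12 / Ψ) := fun j => by
    have h1 : (M ^ j) 0 1 = divDiff a b j * (p12 / 4) := by simp [hMpow j]; simp [hM]
    have h2 := mul_le_mul_of_nonneg_right (hh j) (show 0 ≤ p12 / 4 by positivity)
    rw [h1]; refine h2.trans_eq ?_; ring
  have hM10 : ∀ j, (M ^ j) 1 0 ≤ lam ^ j * (p21 / Ψ) := fun j => by
    have h1 : (M ^ j) 1 0 = divDiff a b j * (p21 / 4) := by simp [hMpow j]; simp [hM]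
    have h2 := mul_le_mul_of_nonneg_right (hh j) (show 0 ≤ p21 / 4 by positivity)
    rw [h1]; refine h2.trans_eq ?_; ring
  have hM0 : ∀ i j, 0 ≤ M i j := by
    intro i j; fin_cases i <;> fin_cases j <;> simp [hM] <;> linarith
  have key := le_sum_pow_mulVec hM0 (u := fun k => ![x k, y k]) (w := fun k => ![F k, G k])
    (by intro i; fin_cases i <;> simp [hx0, hy0])
    (by intro k i; fin_cases i <;> simp [hM] <;> linarith [hx k, hy k]) k
  constructor
  · have h := key 0
    simp only [Matrix.cons_val_zero, Finset.sum_apply] at h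
    refine h.trans ?_
    rw [geomConv_eq_sum]
    refine Finset.sum_le_sum fun t _ => ?_
    simp only [Matrix.mulVec, dotProduct, Fin.sum_univ_two, Matrix.cons_val_zero,
      Matrix.cons_val_one]
    have h1 := mul_le_mul_of_nonneg_right (hM00 (k - t)) (hF t)
    have h2 := mul_le_mul_of_nonneg_right (hM01 (k - t)) (hG t)
    linarith
  · have h := key 1
    simp only [Matrix.cons_val_one, Finset.sum_apply] at h
    refine h.trans ?_
    rw [geomConv_eq_sum]
    refine Finset.sum_le_sum fun t _ => ?_
    simp only [Matrix.mulVec, dotProduct, Fin.sum_univ_two, Matrix.cons_val_zero,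
      Matrix.cons_val_one]
    have h1 := mul_le_mul_of_nonneg_right (hM10 (k - t)) (hF t)
    have h2 := mul_le_mul_of_nonneg_right (hM11 (k - t)) (hG t)
    linarith

/-! ### Smooth objectives -/

section Smooth
variable {n m : ℕ} {L : ℝ}

lemma IsLSmooth.le_quadratic {g : EuclideanSpace ℝ (Fin m) → ℝ} (hg : IsLSmooth L g)
    (x y : EuclideanSpace ℝ (Fin m)) :
    g y ≤ g x + inner ℝ (gradient g x) (y - x) + L / 2 * ‖y - x‖ ^ 2 := by
  set v := y - x with hv
  -- Along the segment, g minus its quadratic majorant is non-increasing by Cauchy–Schwarz and the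
  -- Lipschitz bound.
  let φ : ℝ → ℝ := fun t => g (x + t • v) - t * inner ℝ (gradient g x) v - L / 2 * t ^ 2 * ‖v‖ ^ 2
  have hφ : ∀ t, HasDerivAt φ
      (inner ℝ (gradient g (x + t • v) - gradient g x) v - L * t * ‖v‖ ^ 2) t := fun t => by
    have h1 : HasDerivAt (fun t : ℝ => x + t • v) v t := by
      simpa using ((hasDerivAt_id t).smul_const v).const_add x
    have h2 := (hg.1 (x + t • v)).hasGradientAt.hasFDerivAt.comp_hasDerivAt t h1
    have h3 : HasDerivAt (fun t : ℝ => t * inner ℝ (gradient g x) v) (inner ℝ (gradient g x) v) t := by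
      simpa using (hasDerivAt_id t).mul_const (inner ℝ (gradient g x) v)
    have h4 : HasDerivAt (fun t : ℝ => L / 2 * t ^ 2 * ‖v‖ ^ 2) (L * t * ‖v‖ ^ 2) t := by
      refine (((hasDerivAt_pow 2 t).const_mul (L / 2)).mul_const (‖v‖ ^ 2)).congr_deriv ?_
      push_cast; ring
    refine HasDerivAt.congr_deriv (f := φ) ((h2.sub h3).sub h4) ?_
    rw [inner_sub_left, InnerProductSpace.toDual_apply_apply]
  have hanti : AntitoneOn φ (Set.Icc 0 1) := by
    refine antitoneOn_of_deriv_nonpos (convex_Icc 0 1)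
      (fun t _ => (hφ t).continuousAt.continuousWithinAt)
      (fun t _ => (hφ t).differentiableAt.differentiableWithinAt) fun t ht => ?_
    rw [interior_Icc] at ht
    rw [(hφ t).deriv, sub_nonpos]
    calc inner ℝ (gradient g (x + t • v) - gradient g x) v
        ≤ ‖gradient g (x + t • v) - gradient g x‖ * ‖v‖ := real_inner_le_norm _ _
      _ ≤ L * ‖x + t • v - x‖ * ‖v‖ := by gcongr; exact hg.2 _ _
      _ = L * t * ‖v‖ ^ 2 := by
          rw [add_sub_cancel_left, norm_smul, Real.norm_of_nonneg ht.1.le]; ring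
  have h := hanti (Set.left_mem_Icc.2 zero_le_one) (Set.right_mem_Icc.2 zero_le_one) zero_le_one
  simp only [φ, one_smul, zero_smul, add_zero, hv, add_sub_cancel] at h
  rw [hv]
  linarith

variable {f : Fin n → EuclideanSpace ℝ (Fin m) → ℝ}

lemma hasGradientAt_globalObj (hf : ∀ i, Differentiable ℝ (f i)) (x : EuclideanSpace ℝ (Fin m)) :
    HasGradientAt (globalObj f) (∑ i, gradient (f i) x) x := by
  rw [hasGradientAt_iff_hasFDerivAt, map_sum]
  exact HasFDerivAt.fun_sum fun i _ => (hf i x).hasGradientAt.hasFDerivAt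

lemma gradient_globalObj (hf : ∀ i, Differentiable ℝ (f i)) (x : EuclideanSpace ℝ (Fin m)) :
    gradient (globalObj f) x = ∑ i, gradient (f i) x :=
  (hasGradientAt_globalObj hf x).gradient

lemma norm_sum_gradient_sub_le (hf : ∀ i, IsLSmooth L (f i)) (X : Stack n m)
    (x : EuclideanSpace ℝ (Fin m)) :
    ‖∑ i, gradient (f i) (X i) - gradient (globalObj f) x‖ ≤ L * ∑ i, ‖X i - x‖ := by
  rw [gradient_globalObj fun i => (hf i).1, ← Finset.sum_sub_distrib, Finset.mul_sum]
  exact norm_sum_le_of_le _ fun i _ => (hf i).2 _ _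

lemma isLSmooth_globalObj (hf : ∀ i, IsLSmooth L (f i)) : IsLSmooth (n * L) (globalObj f) := by
  have hd := hasGradientAt_globalObj (f := f) fun i => (hf i).1
  refine ⟨fun x => (hd x).differentiableAt, fun x y => ?_⟩
  rw [gradient_globalObj fun i => (hf i).1]
  refine (norm_sum_gradient_sub_le hf (fun _ => x) y).trans_eq ?_
  simp; ring

end Smooth

/-! ### One step of the iteration -/

section Projections
variable {n m : ℕ} {π : Fin n → ℝ}

lemma projR_mul_mat (X : Stack n m) : projR π * X.mat = Matrix.vecMulVec 1 (wavg π X) := by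
  rw [projR, Matrix.vecMulVec_mul]
  ext i j
  simp [Matrix.vecMulVec_apply, Matrix.vecMul, dotProduct, Stack.mat, wavg]

lemma projC_mul_mat (Y : Stack n m) : projC π * Y.mat = Matrix.vecMulVec π (WithLp.ofLp (∑ j, Y j)) := by
  rw [projC, Matrix.vecMulVec_mul]
  ext i j
  simp [Matrix.vecMulVec_apply, Matrix.vecMul, dotProduct, Stack.mat]

lemma mat_sub_wavg (X : Stack n m) :
    Stack.mat (fun i => X i - wavg π X) = (1 - projR π) * X.mat := by
  rw [Matrix.sub_mul, Matrix.one_mul, projR_mul_mat]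
  ext i j
  simp [Stack.mat]

lemma mat_sub_smul_sum (Y : Stack n m) :
    Stack.mat (fun i => Y i - π i • ∑ j, Y j) = (1 - projC π) * Y.mat := by
  rw [Matrix.sub_mul, Matrix.one_mul, projC_mul_mat]
  ext i j
  simp [Stack.mat, Matrix.vecMulVec_apply]

lemma consensusError_eq (N : Seminorm ℝ (Fin n → ℝ)) (X : Stack n m) :
    consensusError N π X = matNorm N ((1 - projR π) * X.mat) := by
  rw [consensusError, stackNorm_eq, mat_sub_wavg]

lemma trackingError_eq (N : Seminorm ℝ (Fin n → ℝ)) (Y : Stack n m) :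
    trackingError N π Y = matNorm N ((1 - projC π) * Y.mat) := by
  rw [trackingError, stackNorm_eq, mat_sub_smul_sum]

lemma consensusError_nonneg (N : Seminorm ℝ (Fin n → ℝ)) (X : Stack n m) :
    0 ≤ consensusError N π X := by
  rw [consensusError_eq]; exact matNorm_nonneg

lemma trackingError_nonneg (N : Seminorm ℝ (Fin n → ℝ)) (Y : Stack n m) :
    0 ≤ trackingError N π Y := by
  rw [trackingError_eq]; exact matNorm_nonneg

lemma euclNorm_le_one (h0 : ∀ i, 0 ≤ π i) (h1 : ∑ i, π i = 1) : euclNorm π ≤ 1 := by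
  refine (sq_le_one_iff₀ (euclNorm_nonneg π)).1 ?_
  rw [euclNorm_sq, ← h1]
  refine Finset.sum_le_sum fun i _ => ?_
  have hi : π i ≤ 1 := h1 ▸ Finset.single_le_sum (fun j _ => h0 j) (Finset.mem_univ i)
  nlinarith [h0 i]

lemma norm_wavg_le (h0 : ∀ i, 0 ≤ π i) (h1 : ∑ i, π i = 1) (X : Stack n m) :
    ‖wavg π X‖ ≤ matNorm (euclSeminorm n) X.mat := by
  refine (norm_sum_le _ _).trans ?_
  calc ∑ i, ‖π i • X i‖ ≤ ∑ i, π i * matNorm (euclSeminorm n) X.mat := by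
        refine Finset.sum_le_sum fun i _ => ?_
        rw [norm_smul, Real.norm_of_nonneg (h0 i)]
        exact mul_le_mul_of_nonneg_left (norm_row_le_matNorm_eucl X i) (h0 i)
    _ = _ := by rw [← Finset.sum_mul, h1, one_mul]

lemma projR_mul_self (h1 : ∑ i, π i = 1) : projR π * projR π = projR π := by
  rw [projR, Matrix.vecMulVec_mul_vecMulVec]; simp [dotProduct, h1]

lemma projC_mul_self (h1 : ∑ i, π i = 1) : projC π * projC π = projC π := by
  rw [projC, Matrix.vecMulVec_mul_vecMulVec]; simp [dotProduct, h1]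

lemma mul_projR {R : Matrix (Fin n) (Fin n) ℝ} (hR : R ∈ Matrix.rowStochastic ℝ (Fin n)) :
    R * projR π = projR π := by
  rw [projR, Matrix.mul_vecMulVec, hR.2]

lemma projR_mul {R : Matrix (Fin n) (Fin n) ℝ} (hπ : IsLeftPerron R π) :
    projR π * R = projR π := by
  rw [projR, Matrix.vecMulVec_mul, hπ.2.1]

lemma mul_projC {C : Matrix (Fin n) (Fin n) ℝ} (hπ : IsRightPerron C π) :
    C * projC π = projC π := by
  rw [projC, Matrix.mul_vecMulVec, hπ.2.1]

lemma projC_mul {C : Matrix (Fin n) (Fin n) ℝ} (hC : C ∈ Matrix.colStochastic ℝ (Fin n)) :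
    projC π * C = projC π := by
  rw [projC, Matrix.vecMulVec_mul, hC.2]

end Projections

/-- The error of a perturbed averaging step. -/
lemma IsAdaptedNorm.step_le {n m : ℕ} {A J : Matrix (Fin n) (Fin n) ℝ}
    {N : Seminorm ℝ (Fin n → ℝ)} (hN : IsAdaptedNorm A J N) (hAJ : A * J = J) (hJA : J * A = J)
    (hJJ : J * J = J) (X Xh Δ : Matrix (Fin n) (Fin m) ℝ) :
    matNorm N ((1 - J) * (X + (A - 1) * Xh + Δ)) ≤ opNorm N (A - J) * matNorm N ((1 - J) * X)
      + (1 + opNorm N (A - J)) * matNorm N (Xh - X) + matNorm N Δ := by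
  have hA := le_opNorm hN.definite hN.le_eucl (A - J)
  have hJ : ∀ x, N ((1 - J).mulVec x) ≤ 1 * N x := fun x =>
    (le_opNorm hN.definite hN.le_eucl (1 - J) x).trans
      (mul_le_mul_of_nonneg_right hN.proj_le (apply_nonneg N x))
  -- Since X + (A − I)X̂ = AX + (A − I)(X̂ − X), the projected broadcast error enters through (A −
  -- J) − (I − J), whose norm is at most σ + 1.
  have e1 : (1 - J) * (A - 1) = (A - J) - (1 - J) := by
    rw [sub_mul, one_mul, mul_sub, hJA, mul_one]; abel
  have e2 : (A - J) * (1 - J) = A - J := by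
    rw [mul_sub, mul_one, sub_mul, hAJ, hJJ, sub_self, sub_zero]
  have h : (1 - J) * (X + (A - 1) * Xh + Δ) = (A - J) * ((1 - J) * X) + (A - J) * (Xh - X)
      - (1 - J) * (Xh - X) + (1 - J) * Δ := by
    rw [Matrix.mul_add, Matrix.mul_add, ← Matrix.mul_assoc, e1, ← Matrix.mul_assoc, e2]
    simp only [Matrix.sub_mul, Matrix.mul_sub]
    abel
  rw [h]
  have hσ := opNorm_nonneg (N := N) (A - J)
  have h1 := matNorm_mul_le (A := (1 - J) * X) hσ hA
  have h2 := matNorm_mul_le (A := Xh - X) hσ hA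
  have h3 := matNorm_mul_le (A := Xh - X) zero_le_one hJ
  have h4 := matNorm_mul_le (A := Δ) zero_le_one hJ
  have h5 := matNorm_add_le (N := N) (A := (A - J) * ((1 - J) * X) + (A - J) * (Xh - X)
      - (1 - J) * (Xh - X)) (B := (1 - J) * Δ)
  have h6 := matNorm_sub_le (N := N) (A := (A - J) * ((1 - J) * X) + (A - J) * (Xh - X))
      (B := (1 - J) * (Xh - X))
  have h7 := matNorm_add_le (N := N) (A := (A - J) * ((1 - J) * X)) (B := (A - J) * (Xh - X))
  linarith

/-- The stack of the local gradients. -/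
def gradStack {n m : ℕ} (f : Fin n → EuclideanSpace ℝ (Fin m) → ℝ) (X : Stack n m) : Stack n m :=
  fun i => gradient (f i) (X i)

lemma norm_broadcast_sub_le {n m : ℕ} {e : Fin n → ℝ} {c : ℝ} (hc : 0 ≤ c) (he : ∀ i, e i ≤ c)
    (new old : Stack n m) (i : Fin n) : ‖broadcast e new old i - new i‖ ≤ c := by
  rw [broadcast]
  split_ifs with h
  · simpa using hc
  · rw [norm_sub_rev]; exact (not_le.1 h).le.trans (he i)

/-! ### Matrix form, broadcast errors and conserved averages of the iterates -/

section Iteration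
variable {n m : ℕ} {R C : Matrix (Fin n) (Fin n) ℝ} {f : Fin n → EuclideanSpace ℝ (Fin m) → ℝ}
  {α : ℝ} {eX eY : Fin n → ℕ → ℝ} {x0 : EuclideanSpace ℝ (Fin m)} {s : ℕ → State n m}

lemma iter_X_mat (hs : s = iter R C f α eX eY x0) (k : ℕ) :
    (s (k + 1)).X.mat = (s k).X.mat + (R - 1) * (s k).Xhat.mat + -(α • (s k).Y.mat) := by
  subst hs
  ext i j
  simp [iter, Stack.mat, Matrix.mul_apply, sub_eq_add_neg]

lemma iter_Y_mat (hs : s = iter R C f α eX eY x0) (k : ℕ) :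
    (s (k + 1)).Y.mat = (s k).Y.mat + (C - 1) * (s k).Yhat.mat
      + ((gradStack f (s (k + 1)).X).mat - (gradStack f (s k).X).mat) := by
  subst hs
  ext i j
  simp only [iter, Stack.mat, Matrix.mul_apply, gradStack, Matrix.of_apply, Matrix.add_apply,
    Matrix.sub_apply, PiLp.add_apply, PiLp.sub_apply, PiLp.smul_apply, smul_eq_mul, WithLp.ofLp_sum,
    Finset.sum_apply]
  ring

lemma iter_Xhat (hs : s = iter R C f α eX eY x0) (k : ℕ) :
    (s (k + 1)).Xhat = broadcast (fun i => eX i (k + 1)) (s (k + 1)).X (s k).Xhat := by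
  subst hs; rfl

lemma iter_Yhat (hs : s = iter R C f α eX eY x0) (k : ℕ) :
    (s (k + 1)).Yhat = broadcast (fun i => eY i (k + 1)) (s (k + 1)).Y (s k).Yhat := by
  subst hs; rfl

/-- A non-increasing summable sequence decreases to 0. Individual thresholds may still be negative.
-/
lemma maxThreshold_nonneg (hanti : Antitone (maxThreshold eX eY))
    (hsum : Summable (maxThreshold eX eY)) (k : ℕ) : 0 ≤ maxThreshold eX eY k :=
  hanti.le_of_tendsto hsum.tendsto_atTop_zero k

lemma le_maxThreshold (k : ℕ) (i : Fin n) : max (eX i k) (eY i k) ≤ maxThreshold eX eY k :=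
  le_ciSup (f := fun i => max (eX i k) (eY i k)) (Set.finite_range _).bddAbove i

lemma norm_Xhat_sub_le (hs : s = iter R C f α eX eY x0) (he : ∀ k, 0 ≤ maxThreshold eX eY k)
    (k : ℕ) (i : Fin n) : ‖(s k).Xhat i - (s k).X i‖ ≤ maxThreshold eX eY k := by
  subst hs
  cases k with
  | zero => simpa [iter] using he 0
  | succ k =>
    rw [iter_Xhat rfl]
    exact norm_broadcast_sub_le (he _) (fun i => (le_max_left _ _).trans (le_maxThreshold _ i)) _ _ i

lemma norm_Yhat_sub_le (hs : s = iter R C f α eX eY x0) (he : ∀ k, 0 ≤ maxThreshold eX eY k)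
    (k : ℕ) (i : Fin n) : ‖(s k).Yhat i - (s k).Y i‖ ≤ maxThreshold eX eY k := by
  subst hs
  cases k with
  | zero => simpa [iter] using he 0
  | succ k =>
    rw [iter_Yhat rfl]
    exact norm_broadcast_sub_le (he _) (fun i => (le_max_right _ _).trans (le_maxThreshold _ i)) _ _ i

lemma sum_sum_smul_eq_zero {A : Matrix (Fin n) (Fin n) ℝ} {v : Fin n → ℝ}
    (h : Matrix.vecMul v A = 0) (X : Stack n m) : ∑ i, v i • ∑ j, A i j • X j = 0 := by
  simp only [Finset.smul_sum, smul_smul]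
  rw [Finset.sum_comm]
  refine Finset.sum_eq_zero fun j _ => ?_
  rw [← Finset.sum_smul]
  have : ∑ i, v i * A i j = 0 := congrFun h j
  rw [this, zero_smul]

lemma sum_iter_Y (hC : C ∈ Matrix.colStochastic ℝ (Fin n)) (hs : s = iter R C f α eX eY x0)
    (k : ℕ) : ∑ i, (s k).Y i = ∑ i, gradient (f i) ((s k).X i) := by
  subst hs
  induction k with
  | zero => rfl
  | succ k ih =>
    have h := sum_sum_smul_eq_zero (A := C - 1) (v := 1) (by
      rw [Matrix.vecMul_sub, hC.2, Matrix.vecMul_one, sub_self]) (iter R C f α eX eY x0 k).Yhat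
    simp only [Pi.one_apply, one_smul] at h
    rw [iter]
    simp only [Finset.sum_sub_distrib, Finset.sum_add_distrib, ih, h]
    abel

lemma wavg_iter_X {πR : Fin n → ℝ} (hπ : IsLeftPerron R πR) (hs : s = iter R C f α eX eY x0)
    (k : ℕ) : wavg πR (s (k + 1)).X = wavg πR (s k).X - α • wavg πR (s k).Y := by
  subst hs
  have h := sum_sum_smul_eq_zero (A := R - 1) (v := πR) (by
    rw [Matrix.vecMul_sub, hπ.2.1, Matrix.vecMul_one, sub_self]) (iter R C f α eX eY x0 k).Xhat
  rw [iter]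
  simp only [wavg, smul_sub, smul_add, Finset.sum_sub_distrib, Finset.sum_add_distrib, h,
    add_zero]
  simp only [Finset.smul_sum, smul_comm α]

/-- A row of RX is a convex combination of rows of X. This gives the factor 2 in the term 2L of `c2`
and `c5`, where the cruder operator bound r could not be used. -/
lemma norm_mulVec_row_le (hR : R ∈ Matrix.rowStochastic ℝ (Fin n)) {X : Stack n m} {c : ℝ}
    (h : ∀ i, ‖X i‖ ≤ c) (i : Fin n) : ‖∑ j, (R - 1) i j • X j‖ ≤ 2 * c := by
  have h1 : ∑ j, (R - 1) i j • X j = ∑ j, R i j • X j - X i := by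
    simp [sub_smul, Matrix.one_apply, ite_smul]
  have h2 : ‖∑ j, R i j • X j‖ ≤ c := by
    refine (norm_sum_le _ _).trans ?_
    calc ∑ j, ‖R i j • X j‖ ≤ ∑ j, R i j * c := by
          refine Finset.sum_le_sum fun j _ => ?_
          rw [norm_smul, Real.norm_of_nonneg (hR.1 i j)]
          exact mul_le_mul_of_nonneg_left (h j) (hR.1 i j)
      _ = c := by rw [← Finset.sum_mul, Matrix.sum_row_of_mem_rowStochastic hR, one_mul]
  rw [h1]
  linarith [norm_sub_le (∑ j, R i j • X j) (X i), h i]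

end Iteration

/-! ### Recursive inequalities -/

/-- A run of the iteration, with all the objects on which it depends, and constants `d` and `r`
comparing the adapted norms and the matrix `R - 1` with the Euclidean norm. -/
structure IsRun {n m : ℕ} (R C : Matrix (Fin n) (Fin n) ℝ) (πR πC : Fin n → ℝ)
    (NR NC : Seminorm ℝ (Fin n → ℝ)) (d r L : ℝ) (f : Fin n → EuclideanSpace ℝ (Fin m) → ℝ)
    (α : ℝ) (e : ℕ → ℝ) (s : ℕ → State n m) : Prop where
  stochR : R ∈ Matrix.rowStochastic ℝ (Fin n)
  stochC : C ∈ Matrix.colStochastic ℝ (Fin n)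
  perronR : IsLeftPerron R πR
  perronC : IsRightPerron C πC
  normR : IsAdaptedNorm R (projR πR) NR
  normC : IsAdaptedNorm C (projC πC) NC
  d_nonneg : 0 ≤ d
  le_normR : ∀ x, euclNorm x ≤ d * NR x
  le_normC : ∀ x, euclNorm x ≤ d * NC x
  r_nonneg : 0 ≤ r
  bound_sub_one : ∀ x, euclNorm ((R - 1).mulVec x) ≤ r * euclNorm x
  L_pos : 0 < L
  smooth : ∀ i, IsLSmooth L (f i)
  α_pos : 0 < α
  e_nonneg : ∀ k, 0 ≤ e k
  X_succ : ∀ k, (s (k + 1)).X.mat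
    = (s k).X.mat + (R - 1) * (s k).Xhat.mat + -(α • (s k).Y.mat)
  Y_succ : ∀ k, (s (k + 1)).Y.mat = (s k).Y.mat + (C - 1) * (s k).Yhat.mat
      + ((gradStack f (s (k + 1)).X).mat - (gradStack f (s k).X).mat)
  Xhat_near : ∀ k i, ‖(s k).Xhat i - (s k).X i‖ ≤ e k
  Yhat_near : ∀ k i, ‖(s k).Yhat i - (s k).Y i‖ ≤ e k
  sum_Y : ∀ k, ∑ i, (s k).Y i = ∑ i, gradient (f i) ((s k).X i)
  wavg_X : ∀ k, wavg πR (s (k + 1)).X = wavg πR (s k).X - α • wavg πR (s k).Y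

namespace IsRun
variable {n m : ℕ} {R C : Matrix (Fin n) (Fin n) ℝ} {πR πC : Fin n → ℝ}
  {NR NC : Seminorm ℝ (Fin n → ℝ)} {d r L : ℝ} {f : Fin n → EuclideanSpace ℝ (Fin m) → ℝ}
  {α : ℝ} {e : ℕ → ℝ} {s : ℕ → State n m}

lemma eucl_consensus_le (h : IsRun R C πR πC NR NC d r L f α e s) (k : ℕ) :
    matNorm (euclSeminorm n) ((1 - projR πR) * (s k).X.mat)
      ≤ d * consensusError NR πR (s k).X := by
  rw [consensusError_eq]
  exact matNorm_le_mul h.d_nonneg h.le_normR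

lemma eucl_tracking_le (h : IsRun R C πR πC NR NC d r L f α e s) (k : ℕ) :
    matNorm (euclSeminorm n) ((1 - projC πC) * (s k).Y.mat)
      ≤ d * trackingError NC πC (s k).Y := by
  rw [trackingError_eq]
  exact matNorm_le_mul h.d_nonneg h.le_normC

lemma norm_sum_Y_sub_le (h : IsRun R C πR πC NR NC d r L f α e s) (k : ℕ) :
    ‖∑ i, (s k).Y i - gradient (globalObj f) (wavg πR (s k).X)‖
      ≤ L * (√n * (d * consensusError NR πR (s k).X)) := by
  rw [h.sum_Y]
  refine (norm_sum_gradient_sub_le h.smooth _ _).trans ?_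
  refine mul_le_mul_of_nonneg_left ?_ h.L_pos.le
  refine (sum_norm_le_sqrt_mul (fun i => (s k).X i - wavg πR (s k).X)).trans ?_
  rw [mat_sub_wavg]
  exact mul_le_mul_of_nonneg_left (h.eucl_consensus_le k) (Real.sqrt_nonneg _)

lemma norm_sum_Y_le (h : IsRun R C πR πC NR NC d r L f α e s) (k : ℕ) :
    ‖∑ i, (s k).Y i‖ ≤ ‖gradient (globalObj f) (wavg πR (s k).X)‖
      + L * (√n * (d * consensusError NR πR (s k).X)) := by
  have h1 := h.norm_sum_Y_sub_le k
  have h2 := norm_sub_norm_le (∑ i, (s k).Y i) (gradient (globalObj f) (wavg πR (s k).X))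
  linarith

/-- Y splits into its tracking error and π_C times the sum of its rows. The latter is ∇f(x̄) up to
the consensus error, and the Euclidean norm of π_C is at most 1. -/
lemma matNorm_Y_le (h : IsRun R C πR πC NR NC d r L f α e s) {N : Seminorm ℝ (Fin n → ℝ)}
    (hN : ∀ x, N x ≤ euclNorm x) (k : ℕ) :
    matNorm N (s k).Y.mat ≤ d * trackingError NC πC (s k).Y
      + (‖gradient (globalObj f) (wavg πR (s k).X)‖
        + L * (√n * (d * consensusError NR πR (s k).X))) := by
  have hdec : (s k).Y.mat = (1 - projC πC) * (s k).Y.mat + projC πC * (s k).Y.mat := by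
    rw [← Matrix.add_mul, sub_add_cancel, Matrix.one_mul]
  refine (matNorm_mono (N := euclSeminorm n) hN).trans ?_
  rw [hdec]
  refine matNorm_add_le.trans (add_le_add (h.eucl_tracking_le k) ?_)
  have h1 : matNorm (euclSeminorm n) (projC πC * (s k).Y.mat)
      = euclSeminorm n πC * ‖∑ i, (s k).Y i‖ := by
    rw [projC_mul_mat, matNorm_vecMulVec]
  rw [euclSeminorm_apply] at h1
  have h2 := mul_le_mul_of_nonneg_right (euclNorm_le_one h.perronC.1 h.perronC.2.2)
    (norm_nonneg (∑ i, (s k).Y i))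
  linarith [h.norm_sum_Y_le k]

lemma consensus_succ_le (h : IsRun R C πR πC NR NC d r L f α e s) (k : ℕ) :
    consensusError NR πR (s (k + 1)).X
      ≤ (opNorm NR (R - projR πR) + α * √n * L * d) * consensusError NR πR (s k).X
        + α * d * trackingError NC πC (s k).Y
        + (α * ‖gradient (globalObj f) (wavg πR (s k).X)‖
          + (1 + opNorm NR (R - projR πR)) * √n * e k) := by
  have h1 := h.normR.step_le (mul_projR h.stochR) (projR_mul h.perronR)
    (projR_mul_self h.perronR.2.2) (s k).X.mat (s k).Xhat.mat (-(α • (s k).Y.mat))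
  rw [← h.X_succ, ← consensusError_eq, ← consensusError_eq, matNorm_neg, matNorm_smul,
    abs_of_pos h.α_pos] at h1
  have h2 : matNorm NR ((s k).Xhat.mat - (s k).X.mat) ≤ √n * e k :=
    (matNorm_mono (N := euclSeminorm n) h.normR.le_eucl).trans
      (matNorm_eucl_mat_le_sqrt (X := fun i => (s k).Xhat i - (s k).X i) (h.e_nonneg k)
        (h.Xhat_near k))
  have h3 := mul_le_mul_of_nonneg_left (h.matNorm_Y_le h.normR.le_eucl k) h.α_pos.le
  have h4 := mul_le_mul_of_nonneg_left h2
    (add_nonneg zero_le_one (opNorm_nonneg (N := NR) (R - projR πR)))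
  linarith

lemma eucl_X_succ_sub_le (h : IsRun R C πR πC NR NC d r L f α e s) (k : ℕ) :
    matNorm (euclSeminorm n) ((s (k + 1)).X.mat - (s k).X.mat)
      ≤ r * (d * consensusError NR πR (s k).X) + √n * (2 * e k)
        + α * (d * trackingError NC πC (s k).Y
          + (‖gradient (globalObj f) (wavg πR (s k).X)‖
            + L * (√n * (d * consensusError NR πR (s k).X)))) := by
  set Z : Stack n m := fun i => (s k).Xhat i - (s k).X i with hZ
  have hZm : Z.mat = (s k).Xhat.mat - (s k).X.mat := rfl
  -- As (R − I)1 = 0, only the consensus error of X contributes to the increment.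
  have e1 : (R - 1) * (1 - projR πR) = R - 1 := by
    rw [mul_sub, mul_one, sub_mul, mul_projR h.stochR, one_mul, sub_self, sub_zero]
  have hdec : (s (k + 1)).X.mat - (s k).X.mat
      = (R - 1) * ((1 - projR πR) * (s k).X.mat) + (R - 1) * Z.mat - α • (s k).Y.mat := by
    rw [h.X_succ, ← Matrix.mul_assoc, e1, hZm, Matrix.mul_sub]
    abel
  have h1 : matNorm (euclSeminorm n) ((R - 1) * ((1 - projR πR) * (s k).X.mat))
      ≤ r * (d * consensusError NR πR (s k).X) :=
    (matNorm_mul_le h.r_nonneg h.bound_sub_one).trans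
      (mul_le_mul_of_nonneg_left (h.eucl_consensus_le k) h.r_nonneg)
  have h2 : matNorm (euclSeminorm n) ((R - 1) * Z.mat) ≤ √n * (2 * e k) := by
    have : (R - 1) * Z.mat = Stack.mat fun i => ∑ j, (R - 1) i j • Z j := by
      ext i j
      simp [Matrix.mul_apply, Stack.mat]
    rw [this]
    exact matNorm_eucl_mat_le_sqrt (mul_nonneg zero_le_two (h.e_nonneg k))
      (norm_mulVec_row_le h.stochR (h.Xhat_near k))
  have h3 := mul_le_mul_of_nonneg_left
    (h.matNorm_Y_le (N := euclSeminorm n) (fun _ => le_rfl) k) h.α_pos.le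
  rw [hdec]
  have h4 := matNorm_sub_le (N := euclSeminorm n)
    (A := (R - 1) * ((1 - projR πR) * (s k).X.mat) + (R - 1) * Z.mat) (B := α • (s k).Y.mat)
  have h5 := matNorm_add_le (N := euclSeminorm n)
    (A := (R - 1) * ((1 - projR πR) * (s k).X.mat)) (B := (R - 1) * Z.mat)
  rw [matNorm_smul, abs_of_pos h.α_pos] at h4
  linarith

lemma tracking_succ_le (h : IsRun R C πR πC NR NC d r L f α e s) (k : ℕ) :
    trackingError NC πC (s (k + 1)).Y
      ≤ (r + α * √n * L) * L * d * consensusError NR πR (s k).X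
        + (opNorm NC (C - projC πC) + α * L * d) * trackingError NC πC (s k).Y
        + (α * L * ‖gradient (globalObj f) (wavg πR (s k).X)‖
          + (2 * L + 1 + opNorm NC (C - projC πC)) * √n * e k) := by
  have h1 := h.normC.step_le (mul_projC h.perronC) (projC_mul h.stochC)
    (projC_mul_self h.perronC.2.2) (s k).Y.mat (s k).Yhat.mat
    ((gradStack f (s (k + 1)).X).mat - (gradStack f (s k).X).mat)
  rw [← h.Y_succ, ← trackingError_eq, ← trackingError_eq] at h1
  have h2 : matNorm NC ((s k).Yhat.mat - (s k).Y.mat) ≤ √n * e k :=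
    (matNorm_mono (N := euclSeminorm n) h.normC.le_eucl).trans
      (matNorm_eucl_mat_le_sqrt (X := fun i => (s k).Yhat i - (s k).Y i) (h.e_nonneg k)
        (h.Yhat_near k))
  have h3 : matNorm NC ((gradStack f (s (k + 1)).X).mat - (gradStack f (s k).X).mat)
      ≤ L * matNorm (euclSeminorm n) ((s (k + 1)).X.mat - (s k).X.mat) :=
    (matNorm_mono (N := euclSeminorm n) h.normC.le_eucl).trans
      (matNorm_eucl_mat_le_of_rows
        (X := fun i => (s (k + 1)).X i - (s k).X i)
        (X' := fun i => gradStack f (s (k + 1)).X i - gradStack f (s k).X i)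
        h.L_pos.le fun i => (h.smooth i).2 _ _)
  have h4 := mul_le_mul_of_nonneg_left (h.eucl_X_succ_sub_le k) h.L_pos.le
  have h5 := mul_le_mul_of_nonneg_left h2
    (add_nonneg zero_le_one (opNorm_nonneg (N := NC) (C - projC πC)))
  linarith

lemma perron_mul_nonneg (h : IsRun R C πR πC NR NC d r L f α e s) : 0 ≤ ∑ i, πC i * πR i :=
  Finset.sum_nonneg fun i _ => mul_nonneg (h.perronC.1 i) (h.perronR.1 i)

/-- With p = π_Rᵀπ_C, the difference π_RᵀY − p∇f(x̄) equals p(1ᵀY − ∇f(x̄)) + π_Rᵀ(Y − π_C1ᵀY): a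
consensus part and a tracking part. -/
lemma norm_wavg_Y_sub_le (h : IsRun R C πR πC NR NC d r L f α e s) (k : ℕ) :
    ‖wavg πR (s k).Y - (∑ i, πC i * πR i) • gradient (globalObj f) (wavg πR (s k).X)‖
      ≤ (∑ i, πC i * πR i) * (L * (√n * (d * consensusError NR πR (s k).X)))
        + d * trackingError NC πC (s k).Y := by
  set p := ∑ i, πC i * πR i with hp
  have hdec : wavg πR (s k).Y - p • gradient (globalObj f) (wavg πR (s k).X)
      = p • (∑ i, (s k).Y i - gradient (globalObj f) (wavg πR (s k).X))
        + wavg πR (fun i => (s k).Y i - πC i • ∑ j, (s k).Y j) := by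
    simp only [wavg, smul_sub, Finset.sum_sub_distrib, smul_smul, ← Finset.sum_smul]
    simp only [hp, mul_comm (πR _)]
    abel
  have h1 : ‖wavg πR (fun i => (s k).Y i - πC i • ∑ j, (s k).Y j)‖
      ≤ d * trackingError NC πC (s k).Y := by
    refine (norm_wavg_le h.perronR.1 h.perronR.2.2 _).trans ?_
    rw [mat_sub_smul_sum]
    exact h.eucl_tracking_le k
  rw [hdec]
  refine (norm_add_le _ _).trans (add_le_add ?_ h1)
  rw [norm_smul, Real.norm_of_nonneg h.perron_mul_nonneg]
  exact mul_le_mul_of_nonneg_left (h.norm_sum_Y_sub_le k) h.perron_mul_nonneg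

/-- Descent of the objective along the averaged iterates. -/
lemma descent (h : IsRun R C πR πC NR NC d r L f α e s) {p g x y : ℝ} {k : ℕ}
    (hp : p = ∑ i, πC i * πR i) (hg : g = ‖gradient (globalObj f) (wavg πR (s k).X)‖)
    (hx : x = consensusError NR πR (s k).X) (hy : y = trackingError NC πC (s k).Y) :
    globalObj f (wavg πR (s (k + 1)).X) ≤ globalObj f (wavg πR (s k).X) - α * p * g ^ 2
      + α * g * (L * √n * p * d * x + d * y)
      + α ^ 2 * (n * L / 2 * (3 * p ^ 2 * g ^ 2)
        + n * L / 2 * (3 * (L * √n * p * d * x) ^ 2) + n * L / 2 * (3 * (d * y) ^ 2)) := by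
  set u := gradient (globalObj f) (wavg πR (s k).X) with hu
  set w := wavg πR (s k).Y with hw
  have hp0 : 0 ≤ p := hp ▸ h.perron_mul_nonneg
  have hE : ‖w - p • u‖ ≤ L * √n * p * d * x + d * y := by
    have := h.norm_wavg_Y_sub_le k
    rw [← hp, ← hx, ← hy] at this
    linarith
  have h1 := (isLSmooth_globalObj h.smooth).le_quadratic (wavg πR (s k).X) (wavg πR (s (k + 1)).X)
  have hstep : wavg πR (s (k + 1)).X - wavg πR (s k).X = -(α • w) := by
    rw [h.wavg_X]; abel
  rw [hstep, ← hu, norm_neg, norm_smul, Real.norm_of_nonneg h.α_pos.le, inner_neg_right,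
    inner_smul_right] at h1
  have hin : inner ℝ u w = p * g ^ 2 + inner ℝ u (w - p • u) := by
    rw [inner_sub_right, inner_smul_right, real_inner_self_eq_norm_sq, hg]; ring
  have h2 : -inner ℝ u (w - p • u) ≤ g * (L * √n * p * d * x + d * y) := by
    have h3 := neg_le_of_abs_le (abs_real_inner_le_norm u (w - p • u))
    have h4 := mul_le_mul_of_nonneg_left hE (norm_nonneg u)
    rw [hg]; linarith
  have h3 : ‖w‖ ≤ p * g + (L * √n * p * d * x + d * y) := by
    have h4 : ‖w‖ ≤ ‖p • u‖ + ‖w - p • u‖ := by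
      simpa using norm_add_le (p • u) (w - p • u)
    rw [norm_smul, Real.norm_of_nonneg hp0, ← hg] at h4
    linarith
  have h4 : ‖w‖ ^ 2 ≤ 3 * p ^ 2 * g ^ 2 + 3 * (L * √n * p * d * x) ^ 2 + 3 * (d * y) ^ 2 := by
    refine (pow_le_pow_left₀ (norm_nonneg w) h3 2).trans ?_
    linarith [sq_nonneg (p * g - L * √n * p * d * x), sq_nonneg (p * g - d * y),
      sq_nonneg (L * √n * p * d * x - d * y)]
  have h5 := mul_le_mul_of_nonneg_left h2 h.α_pos.le
  have h6 := mul_le_mul_of_nonneg_left h4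
    (show 0 ≤ α ^ 2 * (n * L / 2) from mul_nonneg (sq_nonneg _)
      (div_nonneg (mul_nonneg (Nat.cast_nonneg n) h.L_pos.le) zero_le_two))
  rw [hin] at h1
  linarith

end IsRun

/-! ### Sums of causal convolutions -/

/-- The sequence `c, a 0, a 1, …`. -/
def forcing (c : ℝ) (a : ℕ → ℝ) : ℕ → ℝ
  | 0 => c
  | k + 1 => a k

lemma sum_forcing_sq_succ (c : ℝ) (a : ℕ → ℝ) (k : ℕ) :
    ∑ t ∈ Finset.range (k + 1), forcing c a t ^ 2 = c ^ 2 + ∑ t ∈ Finset.range k, a t ^ 2 := by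
  rw [Finset.sum_range_succ', add_comm]
  rfl

lemma sum_forcing_sq_le (c : ℝ) (a : ℕ → ℝ) (k : ℕ) :
    ∑ t ∈ Finset.range k, forcing c a t ^ 2 ≤ c ^ 2 + ∑ t ∈ Finset.range k, a t ^ 2 := by
  rw [← sum_forcing_sq_succ, Finset.sum_range_succ]
  exact le_add_of_nonneg_right (sq_nonneg _)

section GeomConv
variable {r : ℝ}

lemma geomConv_mono (hr : 0 ≤ r) {v w : ℕ → ℝ} (h : ∀ t, v t ≤ w t) (k : ℕ) :
    geomConv r v k ≤ geomConv r w k := by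
  induction k with
  | zero => exact h 0
  | succ k ih =>
    rw [geomConv, geomConv]
    exact add_le_add (mul_le_mul_of_nonneg_left ih hr) (h _)

lemma geomConv_forcing (c u v : ℝ) (a b : ℕ → ℝ) (k : ℕ) :
    geomConv r (forcing c fun t => u * a t + v * b t) k
      = c * r ^ k + u * geomConv r (forcing 0 a) k + v * geomConv r (forcing 0 b) k := by
  induction k with
  | zero => simp [geomConv, forcing]
  | succ k ih => simp only [geomConv, forcing, ih, pow_succ]; ring

lemma geomConv_forcing_zero (k : ℕ) : geomConv r (forcing 1 fun _ => 0) k = r ^ k := by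
  induction k with
  | zero => simp [geomConv, forcing]
  | succ k ih => simp [geomConv, forcing, ih, pow_succ, mul_comm]

/-- Young's inequality for the convolution with a geometric sequence. -/
lemma sum_geomConv_sq_le (hr0 : 0 ≤ r) (hr1 : r < 1) (w : ℕ → ℝ) (k : ℕ) :
    ∑ t ∈ Finset.range k, geomConv r w t ^ 2
      ≤ (∑ t ∈ Finset.range k, w t ^ 2) / (1 - r) ^ 2 := by
  have h1 : 0 < 1 - r := sub_pos.2 hr1
  cases k with
  | zero => simp
  | succ k =>
    -- With z the convolution, convexity of the square gives (1 − r)z_{k+1}² ≤ (1 − r)r z_k² +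
    -- w_{k+1}². The extra term r z_k² in the claim makes the induction telescope.
    have key : (1 - r) * ((1 - r) * ∑ t ∈ Finset.range (k + 1), geomConv r w t ^ 2
        + r * geomConv r w k ^ 2) ≤ ∑ t ∈ Finset.range (k + 1), w t ^ 2 := by
      induction k with
      | zero =>
        simp only [zero_add, Finset.range_one, Finset.sum_singleton, geomConv]
        nlinarith [mul_nonneg hr0 (sq_nonneg (w 0))]
      | succ k ih =>
        rw [Finset.sum_range_succ _ (k + 1), Finset.sum_range_succ _ (k + 1)]
        have h2 : (1 - r) * geomConv r w (k + 1) ^ 2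
            ≤ (1 - r) * (r * geomConv r w k ^ 2) + w (k + 1) ^ 2 := by
          rw [geomConv]
          nlinarith [mul_nonneg hr0 (sq_nonneg ((1 - r) * geomConv r w k - w (k + 1)))]
        linarith
    rw [le_div_iff₀ (by positivity)]
    have h3 := mul_nonneg h1.le (mul_nonneg hr0 (sq_nonneg (geomConv r w k)))
    linarith

lemma sum_pow_sq_le (hr0 : 0 ≤ r) (hr1 : r < 1) (k : ℕ) :
    ∑ t ∈ Finset.range k, (r ^ t) ^ 2 ≤ 1 / (1 - r) ^ 2 := by
  have h := sum_geomConv_sq_le hr0 hr1 (forcing 1 fun _ => 0) k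
  simp only [geomConv_forcing_zero] at h
  refine h.trans ?_
  gcongr
  simpa using sum_forcing_sq_le 1 (fun _ => 0) k

lemma sum_geomConv_forcing_sq_le (hr0 : 0 ≤ r) (hr1 : r < 1) (a : ℕ → ℝ) (k : ℕ) :
    ∑ t ∈ Finset.range k, geomConv r (forcing 0 a) t ^ 2
      ≤ (∑ t ∈ Finset.range k, a t ^ 2) / (1 - r) ^ 2 := by
  refine (sum_geomConv_sq_le hr0 hr1 _ k).trans ?_
  exact div_le_div_of_nonneg_right (by simpa using sum_forcing_sq_le 0 a k) (sq_nonneg _)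

/-- Weighted AM–GM with weight 1 − r, followed by Young's inequality; the two halves contribute
equally. -/
lemma sum_mul_geomConv_le (hr0 : 0 ≤ r) (hr1 : r < 1) (a : ℕ → ℝ) (k : ℕ) :
    ∑ t ∈ Finset.range k, a t * geomConv r (forcing 0 a) t
      ≤ (∑ t ∈ Finset.range k, a t ^ 2) / (1 - r) := by
  have h1 : 0 < 1 - r := sub_pos.2 hr1
  have h2 : ∀ t, a t * geomConv r (forcing 0 a) t
      ≤ ((1 - r) * geomConv r (forcing 0 a) t ^ 2 + a t ^ 2 / (1 - r)) / 2 := fun t => by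
    have h3 : a t ^ 2 / (1 - r) = (1 - r) * (a t / (1 - r)) ^ 2 := by field_simp
    have h4 : a t = (1 - r) * (a t / (1 - r)) := by field_simp
    have h5 := mul_nonneg h1.le (sq_nonneg (geomConv r (forcing 0 a) t - a t / (1 - r)))
    rw [h3]
    have h6 : a t * geomConv r (forcing 0 a) t
        = (1 - r) * (a t / (1 - r)) * geomConv r (forcing 0 a) t := by rw [← h4]
    rw [h6]
    linarith
  refine (Finset.sum_le_sum fun t _ => h2 t).trans ?_
  rw [← Finset.sum_div, Finset.sum_add_distrib, ← Finset.mul_sum, ← Finset.sum_div]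
  have h7 := mul_le_mul_of_nonneg_left (sum_geomConv_forcing_sq_le hr0 hr1 a k) h1.le
  have h8 : (1 - r) * ((∑ t ∈ Finset.range k, a t ^ 2) / (1 - r) ^ 2)
      = (∑ t ∈ Finset.range k, a t ^ 2) / (1 - r) := by field_simp
  linarith

/-- A sum weighted by a geometric sequence whose terms are at most `μ` from the index `K` on. -/
lemma sum_mul_pow_le (hr0 : 0 ≤ r) (hr1 : r < 1) {μ : ℝ} {K : ℕ} (hμ0 : 0 ≤ μ)
    (hμ : ∀ t, K ≤ t → r ^ t ≤ μ) (a : ℕ → ℝ) (k : ℕ) :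
    ∑ t ∈ Finset.range k, a t * r ^ t ≤ 1 / (2 * (1 - r)) + (∑ t ∈ Finset.range K, a t ^ 2) / 2
      + μ * (∑ t ∈ Finset.range k, a t ^ 2) / 2 := by
  have h1 : 0 < 1 - r := sub_pos.2 hr1
  -- From a ≤ (1 + a²)/2. In r^t a² the weight r^t is bounded by 1 before K and by μ afterwards.
  have hterm : ∀ t, a t * r ^ t ≤ r ^ t / 2 + (if t < K then a t ^ 2 else 0) / 2
      + μ * a t ^ 2 / 2 := fun t => by
    have hp : 0 ≤ r ^ t := pow_nonneg hr0 t
    have h2 : a t * r ^ t ≤ r ^ t / 2 + r ^ t * a t ^ 2 / 2 := by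
      nlinarith [mul_nonneg hp (sq_nonneg (a t - 1))]
    have h3 : r ^ t * a t ^ 2 ≤ (if t < K then a t ^ 2 else 0) + μ * a t ^ 2 := by
      split_ifs with h
      · have h4 := mul_le_mul_of_nonneg_right (pow_le_one₀ (n := t) hr0 hr1.le) (sq_nonneg (a t))
        have h5 := mul_nonneg hμ0 (sq_nonneg (a t))
        linarith
      · rw [zero_add]
        exact mul_le_mul_of_nonneg_right (hμ t (not_lt.1 h)) (sq_nonneg _)
    linarith
  refine (Finset.sum_le_sum fun t _ => hterm t).trans ?_
  rw [Finset.sum_add_distrib, Finset.sum_add_distrib, ← Finset.sum_div, ← Finset.sum_div,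
    ← Finset.sum_div, ← Finset.mul_sum, ← Finset.sum_filter]
  have h6 : ∑ t ∈ Finset.range k, r ^ t ≤ 1 / (1 - r) := by
    rw [one_div, ← tsum_geometric_of_lt_one hr0 hr1]
    exact (summable_geometric_of_lt_one hr0 hr1).sum_le_tsum _ fun t _ => pow_nonneg hr0 t
  have h7 : ∑ t ∈ Finset.range k with t < K, a t ^ 2 ≤ ∑ t ∈ Finset.range K, a t ^ 2 :=
    Finset.sum_le_sum_of_subset_of_nonneg
      (fun t ht => Finset.mem_range.2 (Finset.mem_filter.1 ht).2) fun t _ _ => sq_nonneg _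
  have h8 : 1 / (2 * (1 - r)) = 1 / (1 - r) / 2 := by field_simp
  rw [h8]
  linarith

/-- Summation of a descent inequality whose error terms are bounded by causal convolutions. -/
lemma sum_descent_le (hr0 : 0 ≤ r) (hr1 : r < 1) {α p κ β1 β2 β3 β4 c0 c1 c2 c3 c4 c5 σ : ℝ}
    {K : ℕ} (hα : 0 < α) (hβ1 : 0 ≤ β1) (hβ2 : 0 ≤ β2) (hβ3 : 0 ≤ β3) (hβ4 : 0 ≤ β4)
    (hc0 : 0 ≤ c0) (hc1 : 0 ≤ c1) (hc4 : 0 ≤ c4) (hc2 : 0 ≤ c2) (hc3 : 0 ≤ c3) (hc5 : 0 ≤ c5)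
    {φ g x y e : ℕ → ℝ} (hg : ∀ t, 0 ≤ g t) (hx : ∀ t, 0 ≤ x t) (hy : ∀ t, 0 ≤ y t)
    (hK : ∀ t, K ≤ t → r ^ t ≤ α / (1 - r)) (he : ∀ k, ∑ t ∈ Finset.range k, e t ^ 2 ≤ σ)
    (hφ : ∀ t, φ (t + 1) ≤ φ t - α * p * g t ^ 2 + α * g t * (β1 * x t + β2 * y t)
      + α ^ 2 * (κ * g t ^ 2 + β3 * x t ^ 2 + β4 * y t ^ 2))
    (hxle : ∀ t, x t ≤ geomConv r (forcing c0 fun t => c1 * α * g t + c2 * e t) t)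
    (hyle : ∀ t, y t ≤ geomConv r (forcing c3 fun t => c4 * α * g t + c5 * e t) t) (k : ℕ) :
    α * p * ∑ t ∈ Finset.range k, g t ^ 2 ≤ φ 0 - φ k
      + α * (c0 * β1 + c3 * β2) * (1 / (2 * (1 - r)) + (∑ t ∈ Finset.range K, g t ^ 2) / 2
        + α / (1 - r) * (∑ t ∈ Finset.range k, g t ^ 2) / 2)
      + α ^ 2 * (c1 * β1 + c4 * β2) * ((∑ t ∈ Finset.range k, g t ^ 2) / (1 - r))
      + (c2 * β1 + c5 * β2) * (α ^ 2 * (∑ t ∈ Finset.range k, g t ^ 2) / 2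
        + σ / (1 - r) ^ 2 / 2)
      + α ^ 2 * κ * ∑ t ∈ Finset.range k, g t ^ 2
      + 3 * α ^ 2 * ((c0 ^ 2 * β3 + c3 ^ 2 * β4) * (1 / (1 - r) ^ 2)
        + α ^ 2 * (c1 ^ 2 * β3 + c4 ^ 2 * β4) * ((∑ t ∈ Finset.range k, g t ^ 2) / (1 - r) ^ 2)
        + (c2 ^ 2 * β3 + c5 ^ 2 * β4) * (σ / (1 - r) ^ 2)) := by
  have h1 : 0 < 1 - r := sub_pos.2 hr1
  set Γ := geomConv r (forcing 0 g) with hΓ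
  set E := geomConv r (forcing 0 e) with hE
  have hx' : ∀ t, x t ≤ c0 * r ^ t + c1 * α * Γ t + c2 * E t := fun t => by
    rw [← geomConv_forcing]; exact hxle t
  have hy' : ∀ t, y t ≤ c3 * r ^ t + c4 * α * Γ t + c5 * E t := fun t => by
    rw [← geomConv_forcing]; exact hyle t
  have three : ∀ a b c z : ℝ, 0 ≤ z → z ≤ a + b + c → z ^ 2 ≤ 3 * (a ^ 2 + b ^ 2 + c ^ 2) :=
    fun a b c z hz hzle => (pow_le_pow_left₀ hz hzle 2).trans <| by
      nlinarith [sq_nonneg (a - b), sq_nonneg (a - c), sq_nonneg (b - c)]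
  have hstep : ∀ t, α * p * g t ^ 2 ≤ φ t - φ (t + 1)
      + α * (c0 * β1 + c3 * β2) * (g t * r ^ t)
      + α ^ 2 * (c1 * β1 + c4 * β2) * (g t * Γ t)
      + (c2 * β1 + c5 * β2) * (α ^ 2 * g t ^ 2 / 2 + E t ^ 2 / 2)
      + α ^ 2 * κ * g t ^ 2
      + 3 * α ^ 2 * ((c0 ^ 2 * β3 + c3 ^ 2 * β4) * (r ^ t) ^ 2
        + α ^ 2 * (c1 ^ 2 * β3 + c4 ^ 2 * β4) * Γ t ^ 2
        + (c2 ^ 2 * β3 + c5 ^ 2 * β4) * E t ^ 2) := fun t => by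
    have i1 := mul_le_mul_of_nonneg_left (hx' t) (mul_nonneg (mul_nonneg hα.le (hg t)) hβ1)
    have i2 := mul_le_mul_of_nonneg_left (hy' t) (mul_nonneg (mul_nonneg hα.le (hg t)) hβ2)
    have i3 := mul_le_mul_of_nonneg_left (three _ _ _ _ (hx t) (hx' t))
      (mul_nonneg (sq_nonneg α) hβ3)
    have i4 := mul_le_mul_of_nonneg_left (three _ _ _ _ (hy t) (hy' t))
      (mul_nonneg (sq_nonneg α) hβ4)
    -- All of α goes to g, so that the gradient part is of order α² and can be absorbed into γ.
    have i5 : (c2 * β1 + c5 * β2) * (α * g t * E t)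
        ≤ (c2 * β1 + c5 * β2) * (α ^ 2 * g t ^ 2 / 2 + E t ^ 2 / 2) := by
      refine mul_le_mul_of_nonneg_left ?_ (by positivity)
      nlinarith [sq_nonneg (α * g t - E t)]
    linarith [hφ t]
  have hsum := Finset.sum_le_sum fun t (_ : t ∈ Finset.range k) => hstep t
  simp only [Finset.sum_add_distrib, ← Finset.mul_sum, ← Finset.sum_div,
    Finset.sum_range_sub'] at hsum
  have j1 := mul_le_mul_of_nonneg_left (sum_mul_pow_le hr0 hr1 (by positivity) hK g k)
    (show 0 ≤ α * (c0 * β1 + c3 * β2) by positivity)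
  have j2 := mul_le_mul_of_nonneg_left (sum_mul_geomConv_le hr0 hr1 g k)
    (show 0 ≤ α ^ 2 * (c1 * β1 + c4 * β2) by positivity)
  have hEσ : ∑ t ∈ Finset.range k, E t ^ 2 ≤ σ / (1 - r) ^ 2 :=
    (sum_geomConv_forcing_sq_le hr0 hr1 e k).trans
      (div_le_div_of_nonneg_right (he k) (sq_nonneg _))
  have j3 := mul_le_mul_of_nonneg_left hEσ (show 0 ≤ c2 * β1 + c5 * β2 by positivity)
  have j4 := mul_le_mul_of_nonneg_left hEσ
    (show 0 ≤ α ^ 2 * (c2 ^ 2 * β3 + c5 ^ 2 * β4) by positivity)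
  have j5 := mul_le_mul_of_nonneg_left (sum_geomConv_forcing_sq_le hr0 hr1 g k)
    (show 0 ≤ α ^ 2 * (α ^ 2 * (c1 ^ 2 * β3 + c4 ^ 2 * β4)) by positivity)
  have j6 := mul_le_mul_of_nonneg_left (sum_pow_sq_le hr0 hr1 k)
    (show 0 ≤ α ^ 2 * (c0 ^ 2 * β3 + c3 ^ 2 * β4) by positivity)
  linarith

end GeomConv

/-! ### The constants -/

namespace Params

/-- Standing assumptions on the constants: signs, large comparison constants of the norms, and the
first bound on the step size. -/
structure Admissible (q : Params) (d r : ℝ) : Prop where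
  one_le_n : 1 ≤ q.n
  L_pos : 0 < q.L
  α_pos : 0 < q.α
  σR_nonneg : 0 ≤ q.σR
  σR_lt_one : q.σR < 1
  σC_nonneg : 0 ≤ q.σC
  σC_lt_one : q.σC < 1
  one_le_d : 1 ≤ d
  r_nonneg : 0 ≤ r
  le_δRC : 12 * q.n * d * (1 + r) ≤ q.δRC
  le_δCR : 12 * q.n * d * (1 + r) ≤ q.δCR
  le_δ2R : 12 * q.n * d * (1 + r) ≤ q.δ2R
  le_δ2C : 12 * q.n * d * (1 + r) ≤ q.δ2C
  ψ_pos : 0 < q.ψ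
  ψ_le : q.ψ ≤ q.Psi
  p_nonneg : 0 ≤ q.p
  p_le_one : q.p ≤ 1
  y0_nonneg : 0 ≤ q.y0
  step : q.StepBound1

variable {q : Params} {d r : ℝ}

lemma P_zero_zero : q.P 0 0 = q.σR + q.α * √q.n * q.L := rfl
lemma P_zero_one : q.P 0 1 = q.α * q.δRC := rfl
lemma P_one_zero : q.P 1 0 = (2 + q.α * √q.n * q.L) * q.L * q.δCR := rfl
lemma P_one_one : q.P 1 1 = q.σC + q.α * q.L := rfl

namespace Admissible

lemma one_le_n_real (h : q.Admissible d r) : (1 : ℝ) ≤ q.n := by exact_mod_cast h.one_le_n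

lemma one_le_sqrt (h : q.Admissible d r) : 1 ≤ √(q.n : ℝ) := Real.one_le_sqrt.2 h.one_le_n_real

lemma le_of_le (h : q.Admissible d r) {δ : ℝ} (hδ : 12 * q.n * d * (1 + r) ≤ δ) :
    12 * q.n * d ≤ δ := by
  have h1 := h.one_le_n_real
  have h2 := h.one_le_d
  have h3 : 0 ≤ 12 * (q.n : ℝ) * d * r := by have := h.r_nonneg; positivity
  linarith

lemma le_of_le' (h : q.Admissible d r) {δ : ℝ} (hδ : 12 * q.n * d * (1 + r) ≤ δ) :
    12 * d * (1 + r) ≤ δ := by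
  refine le_trans ?_ hδ
  have h2 := h.one_le_d
  have h3 := h.r_nonneg
  have h4 := mul_le_mul_of_nonneg_left h.one_le_n_real (show 0 ≤ 12 * d * (1 + r) by positivity)
  linarith

lemma d_le (h : q.Admissible d r) {δ : ℝ} (hδ : 12 * q.n * d ≤ δ) : 12 * d ≤ δ := by
  refine le_trans ?_ hδ
  have h1 := h.one_le_d
  have h2 := mul_le_mul_of_nonneg_left h.one_le_n_real (show 0 ≤ 12 * d by positivity)
  linarith

lemma one_le_of_le (h : q.Admissible d r) {δ : ℝ} (hδ : 12 * q.n * d * (1 + r) ≤ δ) : 1 ≤ δ := by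
  linarith [h.d_le (h.le_of_le hδ), h.one_le_d]

lemma αδRC_lt_one (h : q.Admissible d r) : q.α * q.δRC < 1 := by
  have h1 := h.one_le_of_le h.le_δRC
  have h2 := h.step.trans_le (min_le_right _ _)
  rwa [lt_div_iff₀ (by linarith)] at h2

lemma α_lt_one (h : q.Admissible d r) : q.α < 1 := by
  have h1 := h.one_le_of_le h.le_δRC
  have h2 := h.α_pos
  nlinarith [h.αδRC_lt_one]

lemma α_mul_lt (h : q.Admissible d r) :
    q.α * ((√q.n * q.L + √q.n + 3) * q.L * q.δRC * q.δCR) < (1 - q.σR) * (1 - q.σC) := by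
  have h1 := h.one_le_of_le h.le_δRC
  have h2 := h.one_le_of_le h.le_δCR
  have h3 := h.L_pos
  have h4 := h.step.trans_le (min_le_left _ _)
  rwa [lt_div_iff₀ (by positivity)] at h4

lemma P01_pos (h : q.Admissible d r) : 0 < q.P 0 1 := by
  have h1 := h.one_le_of_le h.le_δRC
  have h2 := h.α_pos
  rw [P_zero_one]; positivity

lemma P10_pos (h : q.Admissible d r) : 0 < q.P 1 0 := by
  have h1 := h.one_le_of_le h.le_δCR
  have h2 := h.α_pos
  have h3 := h.L_pos
  rw [P_one_zero]; positivity

lemma P00_nonneg (h : q.Admissible d r) : 0 ≤ q.P 0 0 := by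
  have h1 := h.σR_nonneg
  have h2 := h.α_pos
  have h3 := h.L_pos
  rw [P_zero_zero]; positivity

lemma P11_nonneg (h : q.Admissible d r) : 0 ≤ q.P 1 1 := by
  have h1 := h.σC_nonneg
  have h2 := h.α_pos
  have h3 := h.L_pos
  rw [P_one_one]; positivity

/-- This says that I − P has positive diagonal and positive determinant, which forces λ < 1. In the
step bound, √nL and 2 of the 3 pay for p₁₂p₂₁ (using α < 1), while √n and the remaining 1 pay for
the diagonal terms α√nL and αL. -/
lemma P_bounds (h : q.Admissible d r) :
    q.P 0 0 < 1 ∧ q.P 1 1 < 1 ∧ q.P 0 1 * q.P 1 0 < (1 - q.P 0 0) * (1 - q.P 1 1) := by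
  have hα := h.α_pos
  have hL := h.L_pos
  have hRC := h.one_le_of_le h.le_δRC
  have hCR := h.one_le_of_le h.le_δCR
  have hσR := h.σR_nonneg
  have hσR1 := h.σR_lt_one
  have hσC := h.σC_nonneg
  have hσC1 := h.σC_lt_one
  have hmain := h.α_mul_lt
  have hs := h.one_le_sqrt
  have hδδ : 1 ≤ q.δRC * q.δCR := by nlinarith
  have hαL : 0 < q.α * q.L := mul_pos hα hL
  have e1 : q.α * q.L ≤ q.α * q.L * (q.δRC * q.δCR) := le_mul_of_one_le_right hαL.le hδδ
  have e2 : q.α * √q.n * q.L ≤ q.α * √q.n * q.L * (q.δRC * q.δCR) :=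
    le_mul_of_one_le_right (by positivity) hδδ
  have e3 : q.α * (q.α * √q.n * q.L * q.L * (q.δRC * q.δCR))
      ≤ q.α * √q.n * q.L * q.L * (q.δRC * q.δCR) :=
    mul_le_of_le_one_left (by positivity) h.α_lt_one.le
  have e4 : 0 ≤ q.α * √q.n * q.L * q.L * (q.δRC * q.δCR) := by positivity
  have e5 : (1 - q.σR) * (1 - q.σC) ≤ 1 - q.σR :=
    mul_le_of_le_one_right (by linarith) (by linarith)
  have e6 : (1 - q.σR) * (1 - q.σC) ≤ 1 - q.σC :=
    mul_le_of_le_one_left (by linarith) (by linarith)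
  have e10 : 0 ≤ q.α * √q.n * q.L * (q.δRC * q.δCR) := by positivity
  rw [P_zero_zero, P_one_one, P_zero_one, P_one_zero]
  refine ⟨by linarith, by linarith, ?_⟩
  have e7 : 0 ≤ q.α * √q.n * q.L * (q.α * q.L) := by positivity
  have e8 : 0 ≤ q.σR * (q.α * q.L) := by positivity
  have e9 : 0 ≤ q.σC * (q.α * √q.n * q.L) := by positivity
  linarith

lemma Psi_sq (h : q.Admissible d r) :
    q.Psi ^ 2 = (q.P 0 0 - q.P 1 1) ^ 2 + 4 * q.P 0 1 * q.P 1 0 := by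
  have := mul_pos h.P01_pos h.P10_pos
  rw [Psi, Real.sq_sqrt]
  linarith [sq_nonneg (q.P 0 0 - q.P 1 1)]

lemma Psi_pos (h : q.Admissible d r) : 0 < q.Psi := h.ψ_pos.trans_le h.ψ_le

lemma Psi_lt (h : q.Admissible d r) : q.Psi < 2 - q.P 0 0 - q.P 1 1 := by
  obtain ⟨h1, h2, h3⟩ := h.P_bounds
  refine lt_of_pow_lt_pow_left₀ 2 (by linarith) ?_
  rw [h.Psi_sq]
  linarith

lemma lam_eq (h : q.Admissible d r) : q.lam = (q.P 0 0 + q.P 1 1 + q.Psi) / 2 := by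
  have h0 := h.P00_nonneg
  have h1 := h.P11_nonneg
  have h2 := h.Psi_pos
  refine spectralRadius_map_eq (b := (q.P 0 0 + q.P 1 1 - q.Psi) / 2) (by ring) ?_
    (abs_le.2 ⟨by linarith, by linarith⟩)
  linear_combination (-1 / 4) * h.Psi_sq

lemma lam_lt_one (h : q.Admissible d r) : q.lam < 1 := by
  rw [h.lam_eq]; linarith [h.Psi_lt]

lemma lam_pos (h : q.Admissible d r) : 0 < q.lam := by
  rw [h.lam_eq]; linarith [h.Psi_pos, h.P00_nonneg, h.P11_nonneg]

/-- The hypothesis on ε in `le_geomConv_of_recursion`: here Ψ ≤ 2, while p₁₂p₂₁ ≥ 2αLδ_{R,C}δ_{C,R}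
and δ_{R,C} ≥ 12√n d. -/
lemma perturbation_le (h : q.Admissible d r) :
    q.α * √q.n * q.L * d * q.Psi ≤ 15 / 16 * (q.P 0 1 * q.P 1 0) := by
  have hα := h.α_pos
  have hL := h.L_pos
  have hd := h.one_le_d
  have hn := h.one_le_n_real
  have hs := h.one_le_sqrt
  have hCR := h.one_le_of_le h.le_δCR
  have hRC := h.le_of_le h.le_δRC
  have hsn : √(q.n : ℝ) ≤ q.n := by
    rw [Real.sqrt_le_left (by linarith)]; nlinarith
  have hΨ : q.Psi ≤ 2 := by linarith [h.Psi_lt, h.P00_nonneg, h.P11_nonneg]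
  have h12 : 12 * (√(q.n : ℝ) * d) ≤ q.δRC := by
    have : √(q.n : ℝ) * d ≤ q.n * d := by gcongr
    linarith
  have h2 : 12 * (√(q.n : ℝ) * d) ≤ q.δRC * q.δCR := by
    have : q.δRC ≤ q.δRC * q.δCR :=
      le_mul_of_one_le_right (by linarith [h.one_le_of_le h.le_δRC]) hCR
    linarith
  have h3 : q.α * √q.n * q.L * d * q.Psi ≤ q.α * √q.n * q.L * d * 2 := by gcongr
  have h4 := mul_le_mul_of_nonneg_left h2 (mul_pos hα hL).le
  have hRC1 := h.one_le_of_le h.le_δRC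
  have h5 : 0 ≤ q.α * q.δRC * (q.α * √q.n * q.L) * q.L * q.δCR := by positivity
  have h6 : 0 ≤ q.α * q.L * (√q.n * d) := by positivity
  rw [P_zero_one, P_one_zero]
  linarith

lemma P01_div_le (h : q.Admissible d r) : q.P 0 1 / q.Psi ≤ 1 / q.ψ := by
  have h1 := h.ψ_le
  have h2 := h.αδRC_lt_one
  have h3 := h.ψ_pos
  rw [← P_zero_one] at h2
  gcongr

lemma P10_div_le (h : q.Admissible d r) :
    q.P 1 0 / q.Psi ≤ (2 * q.L * q.δCR + q.L) / q.ψ := by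
  have h1 := h.ψ_le
  have h3 := h.ψ_pos
  have hα := h.α_pos
  have hL := h.L_pos
  have hRC := h.one_le_of_le h.le_δRC
  have hCR := h.one_le_of_le h.le_δCR
  have hpos : 0 ≤ 2 * q.L * q.δCR + q.L := by positivity
  refine div_le_div₀ hpos ?_ h3 h1
  have hmain := h.α_mul_lt
  have e5 : (1 - q.σR) * (1 - q.σC) ≤ 1 :=
    mul_le_one₀ (by linarith [h.σR_nonneg]) (by linarith [h.σC_lt_one])
      (by linarith [h.σC_nonneg])
  have e1 : q.α * √q.n * q.L * q.δCR ≤ q.α * √q.n * q.L * q.δCR * q.δRC :=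
    le_mul_of_one_le_right (by positivity) hRC
  have e2 : 0 ≤ q.α * ((√q.n * q.L + 3) * q.L * q.δRC * q.δCR) := by positivity
  have e3 : q.α * √q.n * q.L * q.δCR ≤ 1 := by linarith
  have e4 := mul_le_mul_of_nonneg_left e3 hL.le
  rw [P_one_zero]
  linarith

/-! ### Signs of the constants and the slack left by large comparison constants -/

section Signs
variable (h : q.Admissible d r)
include h

lemma c0_nonneg : 0 ≤ q.c0 := div_nonneg h.y0_nonneg h.ψ_pos.le
lemma c1_nonneg : 0 ≤ q.c1 := by
  have := div_nonneg h.L_pos.le h.ψ_pos.le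
  rw [c1]; linarith
lemma c2_nonneg : 0 ≤ q.c2 := by
  have h1 := h.σR_nonneg
  have h2 := h.σC_nonneg
  have h3 := h.L_pos
  have h4 := h.ψ_pos
  rw [c2]; positivity
lemma L_le_c4 : q.L ≤ q.c4 := by
  have h1 := h.one_le_of_le h.le_δCR
  have h3 := h.L_pos
  have h4 := h.ψ_pos
  rw [c4]; exact le_add_of_nonneg_right (by positivity)
lemma c4_nonneg : 0 ≤ q.c4 := h.L_pos.le.trans h.L_le_c4
lemma c5_nonneg : 0 ≤ q.c5 := by
  have h0 := h.one_le_of_le h.le_δCR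
  have h1 := h.σR_nonneg
  have h2 := h.σC_nonneg
  have h3 := h.L_pos
  have h4 := h.ψ_pos
  rw [c5]; positivity
lemma le_b1 : q.L * √q.n * q.p * d ≤ q.b1 := by
  have h0 := h.d_le (h.le_of_le h.le_δ2R)
  have h1 := h.one_le_d
  have h2 := h.p_nonneg
  have h3 := h.L_pos
  rw [b1]
  exact mul_le_mul_of_nonneg_left (by linarith) (by positivity)
lemma b1_nonneg : 0 ≤ q.b1 := by
  have h1 := h.one_le_d
  have h2 := h.p_nonneg
  have h3 := h.L_pos
  exact le_trans (by positivity) h.le_b1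
-- The surplus 11n over d later pays for f being nL-smooth instead of L-smooth.
lemma le_b2 : d + 11 * q.n ≤ q.b2 := by
  have h0 := h.le_of_le h.le_δ2C
  have h1 := h.one_le_d
  have h2 := h.one_le_n_real
  rw [b2]
  nlinarith [mul_nonneg (sub_nonneg.2 h1) (sub_nonneg.2 h2)]
lemma b2_pos : 0 < q.b2 := by
  linarith [h.le_b2, h.one_le_d, h.one_le_n_real]
lemma n_mul_sq_le {δ : ℝ} (hδ : 12 * q.n * d ≤ δ) : 144 * q.n * d ^ 2 ≤ δ ^ 2 := by
  have h1 := h.one_le_d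
  have h2 := h.one_le_n_real
  have h3 : (12 * q.n * d) ^ 2 ≤ δ ^ 2 := by gcongr
  have h4 : 144 * (q.n : ℝ) * d ^ 2 * 1 ≤ 144 * q.n * d ^ 2 * q.n := by gcongr
  linarith
lemma le_b3 : 3 * (q.n * q.L / 2 * 3 * (q.L * √q.n * q.p * d) ^ 2) ≤ q.b3 := by
  have h0 := h.n_mul_sq_le (h.le_of_le h.le_δ2R)
  have h3 := h.L_pos
  have h4 : √(q.n : ℝ) ^ 2 = q.n := Real.sq_sqrt (Nat.cast_nonneg _)
  have h5 : 3 / 2 * (q.n * d ^ 2) ≤ q.δ2R ^ 2 := by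
    have : 0 ≤ (q.n : ℝ) * d ^ 2 := by positivity
    linarith
  have h6 := mul_le_mul_of_nonneg_left h5 (show 0 ≤ 3 * q.L ^ 3 * q.n * q.p ^ 2 by positivity)
  rw [b3, mul_pow, mul_pow, mul_pow, h4]
  linarith
lemma b3_nonneg : 0 ≤ q.b3 := by
  have h3 := h.L_pos
  exact le_trans (by positivity) h.le_b3
lemma le_b4 : 3 * (q.n * q.L / 2 * 3 * d ^ 2) ≤ q.b4 := by
  have h0 := h.n_mul_sq_le (h.le_of_le h.le_δ2C)
  have h3 := h.L_pos
  have h5 : 3 / 2 * (q.n * d ^ 2) ≤ q.δ2C ^ 2 := by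
    have : 0 ≤ (q.n : ℝ) * d ^ 2 := by positivity
    linarith
  have h6 := mul_le_mul_of_nonneg_left h5 (show 0 ≤ 3 * q.L by positivity)
  rw [b4]
  linarith
lemma b4_nonneg : 0 ≤ q.b4 := by
  have h3 := h.L_pos
  exact le_trans (by positivity) h.le_b4

lemma bracket_pos : 0 < q.bracket := by
  have i0 := h.c0_nonneg
  have i1 := h.c1_nonneg
  have i2 := h.c2_nonneg
  have i3 : 0 ≤ q.c3 := h.y0_nonneg
  have i4 := h.L_pos.trans_le h.L_le_c4
  have i5 := h.c5_nonneg
  have j1 := h.b1_nonneg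
  have j2 := h.b2_pos
  have j3 := h.b3_nonneg
  have j4 := h.b4_nonneg
  have l := sub_pos.2 h.lam_lt_one
  have hL := h.L_pos
  rw [bracket]
  have t1 : 0 ≤ 3 * q.L * q.p ^ 2 / 2 := by positivity
  have t2 : 0 < (q.c1 * q.b1 + q.c4 * q.b2 + q.c0 * q.b1 + q.c3 * q.b2) / (1 - q.lam) := by
    have : 0 < q.c4 * q.b2 := mul_pos i4 j2
    refine div_pos ?_ l
    have : 0 ≤ q.c1 * q.b1 + q.c0 * q.b1 + q.c3 * q.b2 := by positivity
    linarith
  have t3 : 0 ≤ (q.c1 ^ 2 * q.b3 + q.c4 ^ 2 * q.b4) / (1 - q.lam) ^ 2 := by positivity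
  have t4 : 0 ≤ (q.c2 * q.b1 + q.c5 * q.b2) / 2 := by positivity
  linarith

lemma γ_pos (h2 : q.StepBound2) : 0 < q.γ := by
  rw [StepBound2, inv_mul_eq_div, lt_div_iff₀ h.bracket_pos] at h2
  have := mul_lt_mul_of_pos_left h2 h.α_pos
  rw [γ]
  linarith

/-- The index k₀ solves λ^{k₀} = α/(1 − λ), and ln λ < 0. The floor of k₀ + 1 forces t > k₀, also
when k₀ is negative. -/
lemma pow_le_of_k0_lt {t : ℕ} (ht : ⌊q.k0 + 1⌋₊ ≤ t) : q.lam ^ t ≤ q.α / (1 - q.lam) := by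
  have hl := h.lam_pos
  have hl1 := sub_pos.2 h.lam_lt_one
  have hα := h.α_pos
  have h1 : q.k0 < t := by
    have := (Nat.lt_floor_add_one (q.k0 + 1)).trans_le
      (show (⌊q.k0 + 1⌋₊ : ℝ) + 1 ≤ t + 1 by exact_mod_cast Nat.succ_le_succ ht)
    linarith
  have hlog : Real.log q.lam < 0 := Real.log_neg hl h.lam_lt_one
  rw [k0, div_lt_iff_of_neg hlog, ← Real.log_div hα.ne' hl1.ne', ← Real.log_pow] at h1
  exact ((Real.log_lt_log_iff (by positivity) (by positivity)).1 h1).le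

end Signs

end Admissible

end Params

/-! ### Consequences of the recursive inequalities -/

/-- Gradient norms `g`, consensus errors `x`, tracking errors `y`, thresholds `e` and objective
values `φ` subject to the recursive inequalities of a run of the iteration. -/
structure IsErrorSystem (q : Params) (d r low : ℝ) (g x y e φ : ℕ → ℝ) : Prop where
  admissible : q.Admissible d r
  g_nonneg : ∀ t, 0 ≤ g t
  x_nonneg : ∀ t, 0 ≤ x t
  y_nonneg : ∀ t, 0 ≤ y t
  e_nonneg : ∀ t, 0 ≤ e t
  e_antitone : Antitone e
  e_summable : Summable e
  low_le : ∀ t, low ≤ φ t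
  x_zero : x 0 = 0
  y_zero : y 0 = q.y0
  x_succ : ∀ k, x (k + 1) ≤ (q.σR + q.α * √q.n * q.L * d) * x k + q.α * d * y k
    + (q.α * g k + (1 + q.σR) * √q.n * e k)
  y_succ : ∀ k, y (k + 1) ≤ (r + q.α * √q.n * q.L) * q.L * d * x k
    + (q.σC + q.α * q.L * d) * y k + (q.α * q.L * g k + (2 * q.L + 1 + q.σC) * √q.n * e k)
  φ_succ : ∀ k, φ (k + 1) ≤ φ k - q.α * q.p * g k ^ 2
    + q.α * g k * (q.L * √q.n * q.p * d * x k + d * y k)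
    + q.α ^ 2 * (q.n * q.L / 2 * (3 * q.p ^ 2 * g k ^ 2)
      + q.n * q.L / 2 * (3 * (q.L * √q.n * q.p * d * x k) ^ 2) + q.n * q.L / 2 * (3 * (d * y k) ^ 2))

namespace IsErrorSystem
variable {q : Params} {d r low : ℝ} {g x y e φ : ℕ → ℝ}

lemma errors_le (h : IsErrorSystem q d r low g x y e φ) (k : ℕ) :
    x k ≤ geomConv q.lam (forcing q.c0 fun t => q.c1 * q.α * g t + q.c2 * e t) k ∧
      y k ≤ geomConv q.lam (forcing q.c3 fun t => q.c4 * q.α * g t + q.c5 * e t) k := by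
  have ha := h.admissible
  have hα := ha.α_pos
  have hL := ha.L_pos
  have hd := ha.one_le_d
  have hr := ha.r_nonneg
  have hσR := ha.σR_nonneg
  have hσC := ha.σC_nonneg
  have hs := ha.one_le_sqrt
  -- The forcing starts at 0 because all agents share the initial point, so initial data enter only
  -- through the tracking error.
  set F : ℕ → ℝ := forcing 0 fun t => q.α * g t + (1 + q.σR) * √q.n * e t with hFdef
  set G : ℕ → ℝ := forcing q.y0 fun t =>
    q.α * q.L * g t + (2 * q.L + 1 + q.σC) * √q.n * e t with hGdef
  have hF : ∀ t, 0 ≤ F t := fun t => by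
    cases t with
    | zero => exact le_rfl
    | succ t =>
      have h1 := h.g_nonneg t
      have h2 := h.e_nonneg t
      change 0 ≤ q.α * g t + (1 + q.σR) * √q.n * e t
      positivity
  have hG : ∀ t, 0 ≤ G t := fun t => by
    cases t with
    | zero => exact ha.y0_nonneg
    | succ t =>
      have h1 := h.g_nonneg t
      have h2 := h.e_nonneg t
      change 0 ≤ q.α * q.L * g t + (2 * q.L + 1 + q.σC) * √q.n * e t
      positivity
  have hx : ∀ k, x (k + 1) ≤ (q.P 0 0 + q.α * √q.n * q.L * d) * x k + q.P 0 1 / 4 * y k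
      + F (k + 1) := fun k => by
    refine (h.x_succ k).trans (add_le_add (add_le_add ?_ ?_) le_rfl)
    · refine mul_le_mul_of_nonneg_right ?_ (h.x_nonneg k)
      rw [Params.P_zero_zero]
      have : 0 ≤ q.α * √q.n * q.L := by positivity
      linarith
    · refine mul_le_mul_of_nonneg_right ?_ (h.y_nonneg k)
      rw [Params.P_zero_one, mul_div_assoc]
      refine mul_le_mul_of_nonneg_left ?_ hα.le
      linarith [ha.d_le (ha.le_of_le ha.le_δRC)]
  have hy : ∀ k, y (k + 1) ≤ q.P 1 0 / 4 * x k + (q.P 1 1 + q.α * √q.n * q.L * d) * y k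
      + G (k + 1) := fun k => by
    refine (h.y_succ k).trans (add_le_add (add_le_add ?_ ?_) le_rfl)
    · refine mul_le_mul_of_nonneg_right ?_ (h.x_nonneg k)
      have h1 : 4 * (d * (1 + r)) ≤ q.δCR := by
        have := ha.le_of_le' ha.le_δCR
        have : 0 ≤ d * (1 + r) := by positivity
        linarith
      have h2 := mul_le_mul_of_nonneg_left h1
        (show 0 ≤ (2 + q.α * √q.n * q.L) * q.L by positivity)
      have h3 : 0 ≤ q.α * √q.n * q.L * q.L * d * r := by positivity
      have h4 : 0 ≤ q.L * d * r := by positivity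
      have h5 : 0 ≤ q.L * d := by positivity
      rw [Params.P_one_zero]
      linarith
    · refine mul_le_mul_of_nonneg_right ?_ (h.y_nonneg k)
      have h1 := mul_le_mul_of_nonneg_left hs (show 0 ≤ q.α * q.L * d by positivity)
      have h2 : 0 ≤ q.α * q.L := by positivity
      rw [Params.P_one_one]
      linarith
  obtain ⟨kx, ky⟩ := le_geomConv_of_recursion ha.P00_nonneg ha.P01_pos ha.P10_pos ha.P11_nonneg
    (by positivity) (rfl : q.Psi = _) ha.lam_eq ha.perturbation_le hF hG h.x_zero.le h.y_zero.le
    hx hy k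
  refine ⟨kx.trans (geomConv_mono ha.lam_pos.le (fun t => ?_) k),
    ky.trans (geomConv_mono ha.lam_pos.le (fun t => ?_) k)⟩
  · have h1 := mul_le_mul_of_nonneg_right ha.P01_div_le (hG t)
    refine (add_le_add_right h1 _).trans_eq ?_
    cases t with
    | zero => simp only [hFdef, hGdef, forcing, Params.c0]; ring
    | succ t => simp only [hFdef, hGdef, forcing, Params.c1, Params.c2]; ring
  · have h1 := mul_le_mul_of_nonneg_right ha.P10_div_le (hF t)
    refine (add_le_add_left h1 _).trans_eq ?_
    cases t with
    | zero => simp only [hFdef, hGdef, forcing, Params.c3]; ring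
    | succ t => simp only [hFdef, hGdef, forcing, Params.c4, Params.c5]; ring

lemma sum_e_sq_le (h : IsErrorSystem q d r low g x y e φ) (k : ℕ) :
    ∑ t ∈ Finset.range k, e t ^ 2 ≤ e 0 * ∑' t, e t := by
  have h1 := h.e_summable.sum_le_tsum (Finset.range k) fun t _ => h.e_nonneg t
  refine le_trans ?_ (mul_le_mul_of_nonneg_left h1 (h.e_nonneg 0))
  rw [Finset.mul_sum]
  refine Finset.sum_le_sum fun t _ => ?_
  rw [sq]
  exact mul_le_mul_of_nonneg_right (h.e_antitone (Nat.zero_le t)) (h.e_nonneg t)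

lemma sum_x_sq_succ_le (h : IsErrorSystem q d r low g x y e φ) (k : ℕ) :
    ∑ t ∈ Finset.range (k + 1), x t ^ 2 ≤ 2 / (1 - q.lam) ^ 2
      * (q.c0 ^ 2 + q.c1 ^ 2 * q.α ^ 2 * ∑ t ∈ Finset.range k, g t ^ 2
        + q.c2 ^ 2 * ∑ t ∈ Finset.range k, e t ^ 2) := by
  have ha := h.admissible
  have hl := sub_pos.2 ha.lam_lt_one
  -- The error at time t sees gradients and thresholds only before t; hence the sums on the right
  -- are one term shorter.
  have h1 : ∑ t ∈ Finset.range (k + 1), x t ^ 2 ≤ ∑ t ∈ Finset.range (k + 1),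
      geomConv q.lam (forcing q.c0 fun t => q.c1 * q.α * g t + q.c2 * e t) t ^ 2 :=
    Finset.sum_le_sum fun t _ => pow_le_pow_left₀ (h.x_nonneg t) (h.errors_le t).1 2
  refine h1.trans ((sum_geomConv_sq_le ha.lam_pos.le ha.lam_lt_one _ _).trans ?_)
  rw [sum_forcing_sq_succ, div_mul_eq_mul_div]
  refine div_le_div_of_nonneg_right ?_ (sq_nonneg _)
  have h2 : ∑ t ∈ Finset.range k, (q.c1 * q.α * g t + q.c2 * e t) ^ 2
      ≤ 2 * (q.c1 ^ 2 * q.α ^ 2 * ∑ t ∈ Finset.range k, g t ^ 2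
        + q.c2 ^ 2 * ∑ t ∈ Finset.range k, e t ^ 2) := by
    rw [Finset.mul_sum, Finset.mul_sum, ← Finset.sum_add_distrib, Finset.mul_sum]
    refine Finset.sum_le_sum fun t _ => ?_
    nlinarith [sq_nonneg (q.c1 * q.α * g t - q.c2 * e t)]
  linarith [sq_nonneg q.c0]

/-- The bound on the sum of the squared gradient norms, times `γ`. -/
lemma γ_mul_sum_le (h : IsErrorSystem q d r low g x y e φ) (k : ℕ) :
    q.γ * ∑ t ∈ Finset.range k, g t ^ 2 ≤ φ 0 - low
      + (q.c2 * q.b1 + q.c5 * q.b2) * e 0 * (∑' t, e t) / (2 * (1 - q.lam) ^ 2)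
      + q.α * ((q.c0 * q.b1 + q.c3 * q.b2) / (1 - q.lam))
        * (1 + ∑ t ∈ Finset.range ⌊q.k0 + 1⌋₊, g t ^ 2)
      + q.α ^ 2 * ((q.c0 ^ 2 * q.b3 + q.c3 ^ 2 * q.b4
        + (q.c2 ^ 2 * q.b3 + q.c5 ^ 2 * q.b4) * e 0 * ∑' t, e t) / (1 - q.lam) ^ 2) := by
  have ha := h.admissible
  have hα := ha.α_pos
  have hα1 := ha.α_lt_one
  have hL := ha.L_pos
  have hd := ha.one_le_d
  have hp := ha.p_nonneg
  have hl := sub_pos.2 ha.lam_lt_one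
  have i0 := ha.c0_nonneg
  have i1 := ha.c1_nonneg
  have i2 := ha.c2_nonneg
  have i3 : 0 ≤ q.c3 := ha.y0_nonneg
  have i4 := ha.c4_nonneg
  have i5 := ha.c5_nonneg
  have j1 := ha.le_b1
  have j2 := ha.le_b2
  have j3 := ha.le_b3
  have j4 := ha.le_b4
  have hn := ha.one_le_n_real
  set β1 := q.L * √q.n * q.p * d with hβ1
  set β3 := q.n * q.L / 2 * 3 * β1 ^ 2 with hβ3
  set β4 := q.n * q.L / 2 * 3 * d ^ 2 with hβ4
  set κ := q.n * q.L / 2 * (3 * q.p ^ 2) with hκ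
  have hβ1' : 0 ≤ β1 := by positivity
  have hβ3' : 0 ≤ β3 := by positivity
  have hβ4' : 0 ≤ β4 := by positivity
  have main := sum_descent_le ha.lam_pos.le ha.lam_lt_one (κ := κ) (β1 := β1) (β2 := d) (β3 := β3)
    (β4 := β4) hα hβ1' (by linarith) hβ3' hβ4' i0 i1 i4 i2 i3 i5 h.g_nonneg h.x_nonneg h.y_nonneg
    (p := q.p) (fun t ht => ha.pow_le_of_k0_lt ht) h.sum_e_sq_le
    (fun t => (h.φ_succ t).trans_eq (by rw [hβ3, hβ4, hκ]; ring))
    (fun t => (h.errors_le t).1) (fun t => (h.errors_le t).2) k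
  set S := ∑ t ∈ Finset.range k, g t ^ 2 with hS
  set T := ∑ t ∈ Finset.range ⌊q.k0 + 1⌋₊, g t ^ 2 with hT
  set σ := e 0 * ∑' t, e t with hσ
  have hS0 : 0 ≤ S := Finset.sum_nonneg fun _ _ => sq_nonneg _
  have hT0 : 0 ≤ T := Finset.sum_nonneg fun _ _ => sq_nonneg _
  have hσ0 : 0 ≤ σ := by simpa using h.sum_e_sq_le 0
  obtain ⟨ω, hω⟩ : ∃ ω, ω = 1 / (1 - q.lam) := ⟨_, rfl⟩
  have hω1 : 1 ≤ ω := by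
    rw [hω, le_div_iff₀ hl]; linarith [ha.lam_pos]
  have hdiv : ∀ z : ℝ, z / (1 - q.lam) = z * ω := fun z => by rw [hω]; ring
  have hdiv2 : ∀ z : ℝ, z / (1 - q.lam) ^ 2 = z * ω ^ 2 := fun z => by
    rw [hω, one_div, inv_pow]; rfl
  have hdiv3 : ∀ z : ℝ, z / (2 * (1 - q.lam)) = z * ω / 2 := fun z => by rw [hω]; field_simp
  have hdiv4 : ∀ z : ℝ, z / (2 * (1 - q.lam) ^ 2) = z * ω ^ 2 / 2 := fun z => by
    rw [hω]; field_simp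
  simp only [hdiv, hdiv2, hdiv3] at main
  simp only [Params.γ, Params.bracket, hdiv, hdiv2, hdiv4]
  have hlow := h.low_le k
  have hj2 : d ≤ q.b2 := by linarith
  have a0 : q.c0 * β1 + q.c3 * d ≤ q.c0 * q.b1 + q.c3 * q.b2 := by gcongr
  have a0' : 0 ≤ q.c0 * β1 + q.c3 * d := by positivity
  -- The transient: indices up to k₀ stay on the right through T, while the tail is of order α²S and
  -- is absorbed into γ.
  have t1 : q.α * (q.c0 * β1 + q.c3 * d) * (1 * ω / 2 + T / 2 + q.α * ω * S / 2)
      ≤ q.α * (q.c0 * q.b1 + q.c3 * q.b2) * (ω * (1 + T) + q.α * ω * S) := by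
    have u1 : T ≤ ω * T := le_mul_of_one_le_left hT0 hω1
    have u2 : 0 ≤ q.α * ω * S := by positivity
    have u3 : 0 ≤ ω := by linarith
    have u4 : 1 * ω / 2 + T / 2 + q.α * ω * S / 2 ≤ ω * (1 + T) + q.α * ω * S := by linarith
    have u5 : 0 ≤ 1 * ω / 2 + T / 2 + q.α * ω * S / 2 := by positivity
    exact mul_le_mul (mul_le_mul_of_nonneg_left a0 hα.le) u4 u5
      (mul_nonneg hα.le (a0'.trans a0))
  -- Since p ≤ 1, κ = 3nLp²/2 is at most 2nL, which c₄(b₂ − d) ≥ 11nL covers.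
  have t2 : κ + (q.c1 * β1 + q.c4 * d) * ω
      ≤ 3 * q.L * q.p ^ 2 / 2 + (q.c1 * q.b1 + q.c4 * q.b2) * ω := by
    have u1 : q.c1 * β1 ≤ q.c1 * q.b1 := by gcongr
    have u2 : q.c4 * (d + 11 * q.n) ≤ q.c4 * q.b2 := by gcongr
    have u3 : q.L * q.n ≤ q.c4 * q.n := by gcongr; exact ha.L_le_c4
    have u4 : κ ≤ 2 * (q.L * q.n) := by
      have : q.p ^ 2 ≤ 1 := pow_le_one₀ hp ha.p_le_one
      have := mul_le_mul_of_nonneg_left this (show 0 ≤ q.n * q.L / 2 * 3 by positivity)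
      have : 0 ≤ q.L * q.n := by positivity
      rw [hκ]; linarith
    have u5 : κ ≤ (q.c1 * q.b1 + q.c4 * q.b2) - (q.c1 * β1 + q.c4 * d) := by
      have : 0 ≤ q.L * q.n := by positivity
      linarith
    have u6 : 0 ≤ κ := by positivity
    have u7 := mul_le_mul_of_nonneg_right u5 (show 0 ≤ ω by linarith)
    have u8 : κ ≤ κ * ω := le_mul_of_one_le_right u6 hω1
    have u9 : 0 ≤ 3 * q.L * q.p ^ 2 / 2 := by positivity
    linarith
  have t2' := mul_le_mul_of_nonneg_left t2 (show 0 ≤ q.α ^ 2 * S by positivity)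
  have t3 : (q.c2 * β1 + q.c5 * d) * (q.α ^ 2 * S / 2 + σ * ω ^ 2 / 2)
      ≤ (q.c2 * q.b1 + q.c5 * q.b2) * (q.α ^ 2 * S / 2 + σ * ω ^ 2 / 2) := by gcongr
  have quad : ∀ c c' : ℝ, 3 * (c ^ 2 * β3 + c' ^ 2 * β4) ≤ c ^ 2 * q.b3 + c' ^ 2 * q.b4 :=
    fun c c' => by
      have u1 := mul_le_mul_of_nonneg_left j3 (sq_nonneg c)
      have u2 := mul_le_mul_of_nonneg_left j4 (sq_nonneg c')
      linarith
  have t4 := mul_le_mul_of_nonneg_right (quad q.c0 q.c3) (show 0 ≤ q.α ^ 2 * ω ^ 2 by positivity)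
  have t5 := mul_le_mul_of_nonneg_right (quad q.c1 q.c4)
    (show 0 ≤ q.α ^ 2 * (q.α ^ 2 * (S * ω ^ 2)) by positivity)
  have t6 := mul_le_mul_of_nonneg_right (quad q.c2 q.c5)
    (show 0 ≤ q.α ^ 2 * (σ * ω ^ 2) by positivity)
  -- The squared errors contribute at order α⁴; α < 1 lowers this to the α² of γ.
  have t7 : (q.c1 ^ 2 * q.b3 + q.c4 ^ 2 * q.b4) * (q.α ^ 2 * (q.α ^ 2 * (S * ω ^ 2)))
      ≤ (q.c1 ^ 2 * q.b3 + q.c4 ^ 2 * q.b4) * (q.α ^ 2 * (S * ω ^ 2)) := by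
    have u1 := ha.b3_nonneg
    have u2 := ha.b4_nonneg
    refine mul_le_mul_of_nonneg_left ?_ (by positivity)
    refine mul_le_mul_of_nonneg_left ?_ (by positivity)
    exact mul_le_of_le_one_left (by positivity) (pow_le_one₀ hα.le hα1.le)
  have e1 : ∀ z : ℝ, z * e 0 * ∑' t, e t = z * σ := fun z => by rw [hσ]; ring
  simp only [e1]
  linarith

lemma ergodicAvg_le_gradBound (h : IsErrorSystem q d r low g x y e φ) (h2 : q.StepBound2) {k : ℕ}
    (hk : 1 ≤ k) : ergodicAvg (fun t => g t ^ 2) k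
      ≤ q.gradBound (fun t => g t ^ 2) (φ 0 - low) (e 0) (∑' t, e t) k := by
  have hγ := h.admissible.γ_pos h2
  have hl := sub_pos.2 h.admissible.lam_lt_one
  have hk' : (0 : ℝ) < k := by exact_mod_cast hk
  have main := h.γ_mul_sum_le k
  rw [mul_comm, ← le_div_iff₀ hγ] at main
  have := mul_le_mul_of_nonneg_left main (show 0 ≤ 1 / (k : ℝ) by positivity)
  refine this.trans_eq ?_
  rw [Params.gradBound]
  field_simp

lemma ergodicAvg_le_consensusBound (h : IsErrorSystem q d r low g x y e φ) {k : ℕ} (hk : 1 ≤ k) :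
    ergodicAvg (fun t => x t ^ 2) k ≤ q.consensusBound (fun t => g t ^ 2) e k := by
  obtain ⟨j, rfl⟩ := Nat.exists_eq_add_of_le' hk
  have hk' : (0 : ℝ) < (j + 1 : ℕ) := by positivity
  have hl := sub_pos.2 h.admissible.lam_lt_one
  have := mul_le_mul_of_nonneg_left (h.sum_x_sq_succ_le j)
    (show 0 ≤ 1 / ((j + 1 : ℕ) : ℝ) by positivity)
  refine this.trans_eq ?_
  rw [Params.consensusBound, Nat.add_sub_cancel]
  field_simp

lemma exists_sum_g_sq_le (h : IsErrorSystem q d r low g x y e φ) (h2 : q.StepBound2) :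
    ∃ K, ∀ k, ∑ t ∈ Finset.range k, g t ^ 2 ≤ K :=
  ⟨_, fun k => by
    have := h.γ_mul_sum_le k
    rwa [mul_comm, ← le_div_iff₀ (h.admissible.γ_pos h2)] at this⟩

lemma exists_sum_x_sq_le (h : IsErrorSystem q d r low g x y e φ) (h2 : q.StepBound2) :
    ∃ K, ∀ k, ∑ t ∈ Finset.range k, x t ^ 2 ≤ K := by
  obtain ⟨K, hK⟩ := h.exists_sum_g_sq_le h2
  have hl := sub_pos.2 h.admissible.lam_lt_one
  refine ⟨2 / (1 - q.lam) ^ 2 * (q.c0 ^ 2 + q.c1 ^ 2 * q.α ^ 2 * K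
    + q.c2 ^ 2 * (e 0 * ∑' t, e t)), fun k => ?_⟩
  have h1 : ∑ t ∈ Finset.range k, x t ^ 2 ≤ ∑ t ∈ Finset.range (k + 1), x t ^ 2 := by
    rw [Finset.sum_range_succ]; exact le_add_of_nonneg_right (sq_nonneg _)
  refine h1.trans ((h.sum_x_sq_succ_le k).trans ?_)
  have h3 := hK k
  have h4 := h.sum_e_sq_le k
  gcongr

end IsErrorSystem

lemma ergodicAvg_isBigO {a : ℕ → ℝ} (ha : ∀ t, 0 ≤ a t) {K : ℝ}
    (hK : ∀ k, ∑ t ∈ Finset.range k, a t ≤ K) :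
    ergodicAvg a =O[atTop] (fun k : ℕ => 1 / (k : ℝ)) := by
  refine Asymptotics.IsBigO.of_bound K (Eventually.of_forall fun k => ?_)
  have h1 : 0 ≤ ∑ t ∈ Finset.range k, a t := Finset.sum_nonneg fun t _ => ha t
  rw [ergodicAvg, norm_mul, Real.norm_of_nonneg h1, mul_comm]
  exact mul_le_mul_of_nonneg_right (hK k) (norm_nonneg _)

lemma tendsto_zero_of_sum_le {a : ℕ → ℝ} (ha : ∀ t, 0 ≤ a t) {K : ℝ}
    (hK : ∀ k, ∑ t ∈ Finset.range k, a t ≤ K) : Tendsto a atTop (𝓝 0) :=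
  (summable_of_sum_range_le ha hK).tendsto_atTop_zero

end ETPPG

end

open ETPPG in
theorem theorem1 {n : ℕ} (R C : Matrix (Fin n) (Fin n) ℝ)
    (hR : R ∈ Matrix.rowStochastic ℝ (Fin n)) (hC : C ∈ Matrix.colStochastic ℝ (Fin n))
    (hroot : ∃ r, IsSpanningTreeRoot R r ∧ IsSpanningTreeRoot C.transpose r)
    (πR πC : Fin n → ℝ) (hπR : IsLeftPerron R πR) (hπC : IsRightPerron C πC) :
    -- adapted norms exist when the weight matrices have positive diagonals
    ((∀ i, 0 < R i i) → (∀ i, 0 < C i i) →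
      ∃ NR NC : Seminorm ℝ (Fin n → ℝ),
        IsAdaptedNorm R (projR πR) NR ∧ IsAdaptedNorm C (projC πC) NC) ∧
    -- for all adapted norms and all large enough comparison constants
    ∀ NR NC : Seminorm ℝ (Fin n → ℝ),
      IsAdaptedNorm R (projR πR) NR → IsAdaptedNorm C (projC πC) NC →
      ∃ D : ℝ, 0 < D ∧ ∀ δRC δCR δ2R δ2C : ℝ, D ≤ δRC → D ≤ δCR → D ≤ δ2R → D ≤ δ2C →
        (∀ x, NR x ≤ δRC * NC x) ∧ (∀ x, NC x ≤ δCR * NR x) ∧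
        (∀ x, euclNorm x ≤ δ2R * NR x) ∧ (∀ x, euclNorm x ≤ δ2C * NC x) ∧
        ∀ (m : ℕ) (L : ℝ) (f : Fin n → EuclideanSpace ℝ (Fin m) → ℝ)
          (x0 : EuclideanSpace ℝ (Fin m)) (eX eY : Fin n → ℕ → ℝ) (α ψ : ℝ),
          0 < L → (∀ i, IsLSmooth L (f i)) → BddBelow (Set.range (globalObj f)) →
          Antitone (maxThreshold eX eY) → Summable (maxThreshold eX eY) →
          ∀ s : ℕ → State n m, s = iter R C f α eX eY x0 →
          ∀ q : Params, q = runParams R C πR πC NR NC δRC δCR δ2R δ2C L f x0 α ψ →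
          0 < α → 0 < ψ → ψ ≤ q.Psi → q.StepBound1 → q.StepBound2 →
            q.lam < 1 ∧ 0 < q.γ ∧
            (∀ k : ℕ, 1 ≤ k →
              ergodicAvg (gradSq f πR s) k
                ≤ q.gradBound (gradSq f πR s)
                    (globalObj f (wavg πR (s 0).X) - ⨅ x, globalObj f x)
                    (maxThreshold eX eY 0) (∑' t, maxThreshold eX eY t) k) ∧
            (∀ k : ℕ, 1 ≤ k →
              ergodicAvg (consensusSq NR πR s) k
                ≤ q.consensusBound (gradSq f πR s) (maxThreshold eX eY) k) ∧
            ergodicAvg (gradSq f πR s) =O[atTop] (fun k : ℕ => 1 / (k : ℝ)) ∧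
            ergodicAvg (consensusSq NR πR s) =O[atTop] (fun k : ℕ => 1 / (k : ℝ)) ∧
            Tendsto (gradSq f πR s) atTop (𝓝 0) ∧
            Tendsto (consensusSq NR πR s) atTop (𝓝 0) := by
  obtain ⟨ρ, hρR, hρC⟩ := hroot
  refine ⟨fun hdR hdC => ?_, fun NR NC hNR hNC => ?_⟩
  · obtain ⟨NR, hNR⟩ := exists_isAdaptedNorm_rowStochastic hR hdR hρR hπR
    obtain ⟨NC, hNC⟩ := exists_isAdaptedNorm_colStochastic hC hdC hρC hπC
    exact ⟨NR, NC, hNR, hNC⟩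
  have hn : 1 ≤ n := Fin.pos ρ
  have hn' : (1 : ℝ) ≤ n := by exact_mod_cast hn
  obtain ⟨dR, hdR0, hdR⟩ := exists_euclNorm_le NR hNR.definite hNR.le_eucl
  obtain ⟨dC, hdC0, hdC⟩ := exists_euclNorm_le NC hNC.definite hNC.le_eucl
  obtain ⟨r, hr0, hr⟩ := exists_euclNorm_mulVec_le (R - 1)
  obtain ⟨d, hd⟩ : ∃ d, d = 1 + dR + dC := ⟨_, rfl⟩
  have hd1 : 1 ≤ d := by linarith
  have hleR : ∀ x, euclNorm x ≤ d * NR x := fun x =>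
    (hdR x).trans (mul_le_mul_of_nonneg_right (by linarith) (apply_nonneg NR x))
  have hleC : ∀ x, euclNorm x ≤ d * NC x := fun x =>
    (hdC x).trans (mul_le_mul_of_nonneg_right (by linarith) (apply_nonneg NC x))
  have hD : ∀ δ, 12 * n * d * (1 + r) ≤ δ → d ≤ δ := fun δ hδ => by
    refine le_trans ?_ hδ
    have h1 : 1 ≤ 12 * (n : ℝ) * (1 + r) := by nlinarith
    linarith [le_mul_of_one_le_right (show 0 ≤ d by linarith) h1]
  -- The threshold involves only n, the norm comparison constant d ≥ 1 and the Euclidean bound r of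
  -- R − I, so it is fixed before m, L, the objectives and α.
  refine ⟨12 * n * d * (1 + r), by positivity, fun δRC δCR δ2R δ2C h1 h2 h3 h4 => ?_⟩
  refine ⟨fun x => (hNR.le_eucl x).trans ((hleC x).trans ?_),
    fun x => (hNC.le_eucl x).trans ((hleR x).trans ?_), fun x => (hleR x).trans ?_,
    fun x => (hleC x).trans ?_, ?_⟩
  · exact mul_le_mul_of_nonneg_right (hD _ h1) (apply_nonneg NC x)
  · exact mul_le_mul_of_nonneg_right (hD _ h2) (apply_nonneg NR x)
  · exact mul_le_mul_of_nonneg_right (hD _ h3) (apply_nonneg NR x)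
  · exact mul_le_mul_of_nonneg_right (hD _ h4) (apply_nonneg NC x)
  intro m L f x0 eX eY α ψ hL hf hbdd hanti hsum s hs q hq hα hψ hψΨ hstep1 hstep2
  have he := maxThreshold_nonneg hanti hsum
  have hrun : IsRun R C πR πC NR NC d r L f α (maxThreshold eX eY) s :=
    { stochR := hR, stochC := hC, perronR := hπR, perronC := hπC, normR := hNR, normC := hNC
      d_nonneg := by linarith
      le_normR := hleR, le_normC := hleC, r_nonneg := hr0, bound_sub_one := hr, L_pos := hL
      smooth := hf, α_pos := hα, e_nonneg := he
      X_succ := iter_X_mat hs, Y_succ := iter_Y_mat hs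
      Xhat_near := norm_Xhat_sub_le hs he, Yhat_near := norm_Yhat_sub_le hs he
      sum_Y := sum_iter_Y hC hs, wavg_X := wavg_iter_X hπR hs }
  have hp1 : ∑ i, πC i * πR i ≤ 1 := by
    rw [← hπC.2.2]
    refine Finset.sum_le_sum fun i _ => mul_le_of_le_one_right (hπC.1 i) ?_
    rw [← hπR.2.2]
    exact Finset.single_le_sum (fun j _ => hπR.1 j) (Finset.mem_univ i)
  have hadm : q.Admissible d r := by
    subst hq
    exact
      { one_le_n := hn, L_pos := hL, α_pos := hα
        σR_nonneg := opNorm_nonneg _, σR_lt_one := hNR.contract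
        σC_nonneg := opNorm_nonneg _, σC_lt_one := hNC.contract
        one_le_d := hd1, r_nonneg := hr0, le_δRC := h1, le_δCR := h2, le_δ2R := h3, le_δ2C := h4
        ψ_pos := hψ, ψ_le := hψΨ, p_nonneg := hrun.perron_mul_nonneg, p_le_one := hp1
        y0_nonneg := trackingError_nonneg _ _, step := hstep1 }
  have hx0 : consensusError NR πR (s 0).X = 0 := by
    have h0 : wavg πR (s 0).X = x0 := by
      subst hs
      simp [iter, wavg, ← Finset.sum_smul, hπR.2.2]
    have h5 : Stack.mat (fun i => (s 0).X i - wavg πR (s 0).X) = 0 := by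
      rw [h0]
      subst hs
      ext i j
      simp [iter, Stack.mat]
    rw [consensusError, stackNorm_eq, h5]
    simpa using matNorm_smul (N := NR) (A := (0 : Matrix (Fin n) (Fin m) ℝ)) 0
  have hsys : IsErrorSystem q d r (⨅ x, globalObj f x)
      (fun t => ‖gradient (globalObj f) (wavg πR (s t).X)‖)
      (fun t => consensusError NR πR (s t).X) (fun t => trackingError NC πC (s t).Y)
      (maxThreshold eX eY) (fun t => globalObj f (wavg πR (s t).X)) :=
    { admissible := hadm
      g_nonneg := fun _ => norm_nonneg _
      x_nonneg := fun _ => consensusError_nonneg _ _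
      y_nonneg := fun _ => trackingError_nonneg _ _
      e_nonneg := he, e_antitone := hanti, e_summable := hsum
      low_le := fun t => ciInf_le hbdd _
      x_zero := hx0
      y_zero := by subst hq hs; rfl
      x_succ := fun k => by subst hq; exact hrun.consensus_succ_le k
      y_succ := fun k => by subst hq; exact hrun.tracking_succ_le k
      φ_succ := fun k => by subst hq; exact hrun.descent rfl rfl rfl rfl }
  obtain ⟨Kg, hKg⟩ := hsys.exists_sum_g_sq_le hstep2
  obtain ⟨Kx, hKx⟩ := hsys.exists_sum_x_sq_le hstep2
  exact ⟨hadm.lam_lt_one, hadm.γ_pos hstep2, fun k hk => hsys.ergodicAvg_le_gradBound hstep2 hk,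
    fun k hk => hsys.ergodicAvg_le_consensusBound hk,
    ergodicAvg_isBigO (fun _ => sq_nonneg _) hKg, ergodicAvg_isBigO (fun _ => sq_nonneg _) hKx,
    tendsto_zero_of_sum_le (fun _ => sq_nonneg _) hKg,
    tendsto_zero_of_sum_le (fun _ => sq_nonneg _) hKx⟩
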